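/- Let $G$ be a torus of dimension $d\ge 0$, let $\Gamma=\mathrm{Hom}(G,\mathbb S^1)\cong\mathbb Z^d$ be its character group, let $R(G)=\mathbb Z[\Gamma]$ be its character ring, and let $V=\Gamma\otimes_{\mathbb Z}\mathbb R$. Let $\mathcal C[\Gamma]$ be the group of functions $f:\Gamma\to\mathbb Z$, regarded as an $R(G)$-module on which $a\in\Gamma$ acts as the translation $(\tau_a f)(x)=f(x-a)$. Let $X=[a_1,\dots,a_n]$ be a finite list of elements of $\Gamma$ with $\mathrm{rk}(X)=\mathrm{rk}(\Gamma)$, none of which is zero in $V$. A linear subspace $\underline s\subseteq V$ is called rational if it is spanned by a (possibly empty) set of elements of $X$. Put $\nabla_{X\setminus\underline s}=\prod_{a\in X,\ a\notin\underline s}(1-a)\in R(G)$. For $0\le i\le d$, let $\widetilde{\mathcal F}_i(X)$ be the $R(G)$-module of all $f\in\mathcal C[\Gamma]$ such that $\nabla_{X\setminus\underline s}f=0$ for every rational proper subspace $\underline s$ of dimension $<i$, and $\nabla_{X\setminus\underline s}f$ is supported on a finite number of translates of $\underline s$ for every other rational subspace $\underline s$. Let $\mathcal J_i^\nabla\subseteq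 R(G)$ be the ideal generated by the elements $\nabla_{X\setminus\underline s}$ with $\underline s$ rational and $\dim\underline s<i$, and let $\widetilde{\mathcal F}_i^*(X)=R(G)/\mathcal J_i^\nabla$ be the dual DPV module. Then, for every $0\le i\le d$, the $R(G)$-module $\widetilde{\mathcal F}_i^*(X)$ admits a filtration by $R(G)$-submodules $$0=\widetilde{\mathcal F}_{i,d+1}^*(X)\subsetneq\widetilde{\mathcal F}_{i,d}^*(X)\subsetneq\widetilde{\mathcal F}_{i,d-1}^*(X)\subsetneq\dots\subsetneq\widetilde{\mathcal F}_{i,i}^*(X)=\widetilde{\mathcal F}_i^*(X)$$ such that, for every $i\le j\le d$, there is an isomorphism of $R(G)$-modules $$\widetilde{\mathcal F}_{i,j}^*(X)/\widetilde{\mathcal F}_{i,j+1}^*(X)\cong \mathrm{Ext}^{d-j+i}_{R(G)}\big(\widetilde{\mathcal F}_i(X),R(G)\big).$$ Moreover, for every $k\ge 0$, the module $\mathrm{Ext}^k_{R(G)}(\widetilde{\mathcal F}_i(X),R(G))$ is nonzero if and only if $i\le k\le d$; thus the successive quotients are exactly the nonzero Ext groups, each occurring once. -/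

import Mathlib

open scoped TensorProduct

universe u

namespace DPV

noncomputable section

/-- The character ring `R(G)`, i.e. the group algebra over the integers of the character lattice
`Γ = Hom(G, S¹)` of the torus `G`. -/
abbrev CharRing (Γ : Type u) [AddCommGroup Γ] : Type u := AddMonoidAlgebra ℤ Γ

/-- The canonical map from `Γ` to the real vector space `V = ℝ ⊗ Γ`, the dual of the Lie algebra
of the torus. -/
def toV {Γ : Type u} [AddCommGroup Γ] : Γ →ₗ[ℤ] ℝ ⊗[ℤ] Γ := TensorProduct.mk ℤ ℝ Γ 1

/-- `C[Γ]`: the space of integer-valued functions on `Γ`. -/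
def FunSpace (Γ : Type u) : Type u := Γ → ℤ

instance (Γ : Type u) : AddCommGroup (FunSpace Γ) := inferInstanceAs (AddCommGroup (Γ → ℤ))

/-- Translation by `a`: `(τ_a f)(x) = f(x - a)`. -/
def translate {Γ : Type u} [AddCommGroup Γ] (a : Γ) : Module.End ℤ (FunSpace Γ) where
  toFun f := fun x => f (x - a)
  map_add' _ _ := rfl
  map_smul' _ _ := rfl

/-- The translations as an action of the group `Γ` on `C[Γ]`. -/
def translateHom (Γ : Type u) [AddCommGroup Γ] :
    Multiplicative Γ →* Module.End ℤ (FunSpace Γ) where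
  toFun a := translate a.toAdd
  map_one' := by
    refine LinearMap.ext fun f => funext fun x => ?_
    change f (x - 0) = f x
    rw [sub_zero]
  map_mul' a b := by
    refine LinearMap.ext fun f => funext fun x => ?_
    change f (x - (a.toAdd + b.toAdd)) = f (x - a.toAdd - b.toAdd)
    rw [sub_sub]

/-- `C[Γ]` as a module over `R(G)`: the character `a` acts as the translation `τ_a`. -/
instance (Γ : Type u) [AddCommGroup Γ] : Module (CharRing Γ) (FunSpace Γ) :=
  Module.compHom (FunSpace Γ)
    (AddMonoidAlgebra.lift ℤ (Module.End ℤ (FunSpace Γ)) Γ (translateHom Γ)).toRingHom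

theorem single_smul_apply {Γ : Type u} [AddCommGroup Γ] (a : Γ) (c : ℤ) (f : FunSpace Γ) (x : Γ) :
    ((AddMonoidAlgebra.single a c : CharRing Γ) • f : FunSpace Γ) x = c * f (x - a) := by
  change (AddMonoidAlgebra.lift ℤ (Module.End ℤ (FunSpace Γ)) Γ (translateHom Γ)
    (AddMonoidAlgebra.single a c)) f x = _
  rw [AddMonoidAlgebra.lift_single]
  change c • f (x - a) = _
  simp

variable {Γ : Type u} [AddCommGroup Γ]

/-- The difference operator `∇_a = 1 - τ_a`, as an element of `R(G)`. -/
def nabla (a : Γ) : CharRing Γ := 1 - AddMonoidAlgebra.single a 1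

theorem nabla_smul_apply (a : Γ) (f : FunSpace Γ) (x : Γ) :
    (nabla a • f : FunSpace Γ) x = f x - f (x - a) := by
  rw [nabla, sub_smul, one_smul]
  change f x - ((AddMonoidAlgebra.single a 1 : CharRing Γ) • f : FunSpace Γ) x = _
  rw [single_smul_apply, one_mul]

/-- A linear subspace of `V` is rational if it is spanned by some elements of the list `X`
(the zero subspace is spanned by the empty sublist). -/
def IsRational {n : ℕ} (X : Fin n → Γ) (s : Submodule ℝ (ℝ ⊗[ℤ] Γ)) : Prop :=
  ∃ A : Set (Fin n), s = Submodule.span ℝ ((fun k => toV (X k)) '' A)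

open Classical in
/-- `∇_{X \ s}`: the product of `∇_a` over the members `a` of the list `X` not lying in `s`. -/
def nablaCompl {n : ℕ} (X : Fin n → Γ) (s : Submodule ℝ (ℝ ⊗[ℤ] Γ)) : CharRing Γ :=
  ∏ k with toV (X k) ∉ s, nabla (X k)

/-- The functions on `Γ` whose support is contained in the union of finitely many translates of
the subspace `s`. -/
def finTranslates (s : Submodule ℝ (ℝ ⊗[ℤ] Γ)) : Submodule (CharRing Γ) (FunSpace Γ) where
  carrier := {f | ∃ T : Finset (ℝ ⊗[ℤ] Γ), ∀ x : Γ, f x ≠ 0 → ∃ t ∈ T, toV x - t ∈ s}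
  zero_mem' := ⟨∅, fun _ h => absurd rfl h⟩
  add_mem' := by
    classical
    rintro f g ⟨T, hT⟩ ⟨U, hU⟩
    refine ⟨T ∪ U, fun x hx => ?_⟩
    by_cases hf : f x = 0
    · have hg : g x ≠ 0 := by
        intro hg
        apply hx
        change f x + g x = 0
        rw [hf, hg, add_zero]
      obtain ⟨t, ht, h⟩ := hU x hg
      exact ⟨t, Finset.mem_union_right _ ht, h⟩
    · obtain ⟨t, ht, h⟩ := hT x hf
      exact ⟨t, Finset.mem_union_left _ ht, h⟩
  smul_mem' := by
    classical
    rintro r f ⟨T, hT⟩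
    induction r using AddMonoidAlgebra.induction_linear with
    | zero => exact ⟨∅, fun x h => absurd (by rw [zero_smul]; rfl) h⟩
    | add p q hp hq =>
      obtain ⟨P, hP⟩ := hp
      obtain ⟨Q, hQ⟩ := hq
      refine ⟨P ∪ Q, fun x hx => ?_⟩
      by_cases h : (p • f : FunSpace Γ) x = 0
      · have h' : (q • f : FunSpace Γ) x ≠ 0 := by
          intro h'
          apply hx
          rw [add_smul]
          change (p • f : FunSpace Γ) x + (q • f : FunSpace Γ) x = 0
          rw [h, h', add_zero]
        obtain ⟨t, ht, h⟩ := hQ x h'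
        exact ⟨t, Finset.mem_union_right _ ht, h⟩
      · obtain ⟨t, ht, h⟩ := hP x h
        exact ⟨t, Finset.mem_union_left _ ht, h⟩
    | single a c =>
      refine ⟨T.image (fun t => t + toV a), fun x hx => ?_⟩
      rw [single_smul_apply] at hx
      obtain ⟨t, ht, h⟩ := hT (x - a) (right_ne_zero_of_mul hx)
      refine ⟨t + toV a, Finset.mem_image_of_mem _ ht, ?_⟩
      rw [map_sub] at h
      convert h using 1
      abel

/-- The discrete De Concini-Procesi-Vergne module `F̃_i(X)`, an `R(G)`-submodule of `C[Γ]`: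
`∇_{X \ s} f` vanishes for every proper rational `s` of dimension `< i`, and is supported on a
finite number of translates of `s` for every other rational `s`. -/
def dpv {n : ℕ} (X : Fin n → Γ) (i : ℕ) : Submodule (CharRing Γ) (FunSpace Γ) where
  carrier := {f | ∀ s : Submodule ℝ (ℝ ⊗[ℤ] Γ), IsRational X s →
    ((s ≠ ⊤ ∧ Module.finrank ℝ s < i) → nablaCompl X s • f = 0) ∧
    (¬ (s ≠ ⊤ ∧ Module.finrank ℝ s < i) → nablaCompl X s • f ∈ finTranslates s)}
  zero_mem' s _ := by simp
  add_mem' {f g} hf hg s hs := by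
    refine ⟨fun h => ?_, fun h => ?_⟩
    · rw [smul_add, (hf s hs).1 h, (hg s hs).1 h, add_zero]
    · rw [smul_add]
      exact add_mem ((hf s hs).2 h) ((hg s hs).2 h)
  smul_mem' r f hf s hs := by
    refine ⟨fun h => ?_, fun h => ?_⟩
    · rw [smul_comm, (hf s hs).1 h, smul_zero]
    · rw [smul_comm]
      exact Submodule.smul_mem _ r ((hf s hs).2 h)

/-- The ideal `J_i^∇` of `R(G)` generated by the `∇_{X \ s}`, for `s` rational with `dim s < i`. -/
def idealJ {n : ℕ} (X : Fin n → Γ) (i : ℕ) : Ideal (CharRing Γ) :=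
  Ideal.span {r | ∃ s : Submodule ℝ (ℝ ⊗[ℤ] Γ),
    IsRational X s ∧ Module.finrank ℝ s < i ∧ r = nablaCompl X s}

/-- The dual DPV module `F̃_i^*(X) = R(G) / J_i^∇`. -/
abbrev dualDPV {n : ℕ} (X : Fin n → Γ) (i : ℕ) : Type u := CharRing Γ ⧸ idealJ X i

/-- The `R(G)`-module `Ext^k_{R(G)}(F̃_i(X), R(G))`. -/
abbrev extDPV {n : ℕ} (X : Fin n → Γ) (i k : ℕ) : Type u :=
  CategoryTheory.Abelian.Ext (ModuleCat.of (CharRing Γ) (dpv X i))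
    (ModuleCat.of (CharRing Γ) (CharRing Γ)) k

end

end DPV

/-! Write R for the character ring, J_m for `idealJ X m`, and J_s for the cocircuit ideal of a
rational subspace s. The graded pieces of the dual module and the Ext groups are computed
separately; in degree k, for i ≤ k, both turn out to be the product of R/J_s over the rational s of
dimension k.

Dual side. The elements ∇_{X\s} with dim s = k generate J_{k+1} modulo J_k, and the only relations
between them are the obvious ones: if Σ c_s ∇_{X\s} lies in J_k, then each c_s lies in J_s. This is
seen by letting the relation act on functions. A function g supported on finitely many translates of
s and killed by J_s can be written g = ∇_{X\s} f, where f comes from geometric series in directions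
on which a functional vanishing on s is positive (`exists_nablaCompl_smul_eq`). Every ∇_{X\t} with t
not containing s kills f, so the relation collapses to c_s g = 0. Such functions g detect J_s
because R/J_s is free over ℤ. Freeness rests on the same argument modulo a prime
(`mem_relJ_of_prime_mul_mem`), which gives torsion-freeness, and on the integrality of characters
modulo J_s (`isIntegral_chr`), which gives finiteness along the lattice of s.

Function side. The same series show that f ↦ (∇_{X\s} f)_s is surjective in the exact sequence 0 →
`strata X (k+1)` → `strata X k` → ∏ `killed X s` → 0. The module `killed X s` consists of finitely
supported functions on Γ/`lat s` with values in the ℤ-dual of a finite free ℤ-module. Over Γ instead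
of Γ/`lat s` such a module is projective with an explicit dual; dividing out the translations by a
basis of `lat s`, one vector at a time, moves the only nonzero Ext group up by one degree each time
(`Twisted.isExtDual_span`). So Ext of `killed X s` lives in degree dim s, where it is R/J_s. The
long exact sequences, run downwards from `strata X (d+1)` = 0, then split into isomorphisms
(`extRing_strata`).

The required filtration has as j-th term the image of J_{d+1-j+i} in R/J_i. -/

namespace DPV

noncomputable section

open CategoryTheory CategoryTheory.Abelian

/-! ### Functoriality and long exact sequences of Ext with values in the ring. -/

section ExtRing

variable {R : Type u} [CommRing R]
variable {M M₁ M₂ M₃ : Type u} [AddCommGroup M] [Module R M] [AddCommGroup M₁] [Module R M₁]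
  [AddCommGroup M₂] [Module R M₂] [AddCommGroup M₃] [Module R M₃]

variable (R M) in
/-- The `R`-module `Ext^q_R(M, R)`. -/
abbrev ExtRing (q : ℕ) : Type u := Ext (ModuleCat.of R M) (ModuleCat.of R R) q

/-- The contravariant action of linear maps on `Ext^q_R(-, R)`. -/
def extMap (f : M₁ →ₗ[R] M₂) (q : ℕ) : ExtRing R M₂ q →ₗ[R] ExtRing R M₁ q :=
  (Ext.mk₀ (ModuleCat.ofHom f)).precompOfLinear R _ (zero_add q)

theorem extMap_apply (f : M₁ →ₗ[R] M₂) (q : ℕ) (ξ : ExtRing R M₂ q) :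
    extMap f q ξ = (Ext.mk₀ (ModuleCat.ofHom f)).comp ξ (zero_add q) := rfl

theorem extMap_comp (g : M₂ →ₗ[R] M₃) (f : M₁ →ₗ[R] M₂) (q : ℕ) (ξ : ExtRing R M₃ q) :
    extMap (g ∘ₗ f) q ξ = extMap f q (extMap g q ξ) := by
  rw [extMap_apply, extMap_apply, extMap_apply, ModuleCat.ofHom_comp, Ext.mk₀_comp_mk₀_assoc]

theorem extMap_id (q : ℕ) (ξ : ExtRing R M q) : extMap (LinearMap.id : M →ₗ[R] M) q ξ = ξ := by
  rw [extMap_apply, ModuleCat.ofHom_id, Ext.mk₀_id_comp]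

theorem extMap_add (f g : M₁ →ₗ[R] M₂) (q : ℕ) (ξ : ExtRing R M₂ q) :
    extMap (f + g) q ξ = extMap f q ξ + extMap g q ξ := by
  simp only [extMap_apply, ModuleCat.ofHom_add, Ext.mk₀_add, Ext.add_comp]

theorem extMap_zero (q : ℕ) (ξ : ExtRing R M₂ q) :
    extMap (0 : M₁ →ₗ[R] M₂) q ξ = 0 := by
  have := extMap_add (0 : M₁ →ₗ[R] M₂) 0 q ξ
  simpa using this

theorem extMap_sub (f g : M₁ →ₗ[R] M₂) (q : ℕ) (ξ : ExtRing R M₂ q) :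
    extMap (f - g) q ξ = extMap f q ξ - extMap g q ξ := by
  rw [eq_sub_iff_add_eq, ← extMap_add, sub_add_cancel]

theorem extMap_sum {ι : Type*} (s : Finset ι) (f : ι → M₁ →ₗ[R] M₂) (q : ℕ)
    (ξ : ExtRing R M₂ q) : extMap (∑ i ∈ s, f i) q ξ = ∑ i ∈ s, extMap (f i) q ξ := by
  classical
  induction s using Finset.induction_on with
  | empty => simp [extMap_zero]
  | insert a s ha ih => rw [Finset.sum_insert ha, Finset.sum_insert ha, extMap_add, ih]

/-- Isomorphic modules have isomorphic Ext groups. -/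
def extEquiv (e : M₁ ≃ₗ[R] M₂) (q : ℕ) : ExtRing R M₂ q ≃ₗ[R] ExtRing R M₁ q :=
  LinearEquiv.ofLinearMap (extMap e.toLinearMap q) (extMap e.symm.toLinearMap q)
    (LinearMap.ext fun ξ => by
      rw [LinearMap.comp_apply, ← extMap_comp, e.symm_comp, extMap_id, LinearMap.id_apply])
    (LinearMap.ext fun ξ => by
      rw [LinearMap.comp_apply, ← extMap_comp, e.comp_symm, extMap_id, LinearMap.id_apply])

theorem subsingleton_extRing_of_subsingleton [Subsingleton M] (q : ℕ) :
    Subsingleton (ExtRing R M q) := by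
  refine subsingleton_of_forall_eq 0 fun ξ => ?_
  rw [← extMap_id q ξ, Subsingleton.elim (LinearMap.id : M →ₗ[R] M) 0, extMap_zero]

theorem subsingleton_extRing_of_projective [Module.Projective R M] (q : ℕ) (hq : q ≠ 0) :
    Subsingleton (ExtRing R M q) := by
  obtain ⟨q, rfl⟩ := Nat.exists_eq_succ_of_ne_zero hq
  have := ModuleCat.projective_of_categoryTheory_projective (P := ModuleCat.of R M)
  exact Ext.subsingleton_of_projective _ _ q

/-- `Ext⁰` is `Hom`. -/
def extZeroEquiv : ExtRing R M 0 ≃ₗ[R] (M →ₗ[R] R) :=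
  Ext.linearEquiv₀.trans ModuleCat.homLinearEquiv

theorem extZeroEquiv_extMap (f : M₁ →ₗ[R] M₂) (ξ : ExtRing R M₂ 0) :
    extZeroEquiv (extMap f 0 ξ) = extZeroEquiv ξ ∘ₗ f := by
  obtain ⟨φ, rfl⟩ := (Ext.linearEquiv₀ (R := R)).symm.surjective ξ
  have : extMap f 0 ((Ext.linearEquiv₀ (R := R)).symm φ) =
      (Ext.linearEquiv₀ (R := R)).symm (ModuleCat.ofHom f ≫ φ) :=
    Ext.mk₀_comp_mk₀ _ _
  rw [this]
  simp only [extZeroEquiv, LinearEquiv.trans_apply, LinearEquiv.apply_symm_apply]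
  rfl

/-- `Ext^q(-, R)` turns finite products into products. -/
def extPiEquiv {ι : Type*} [Fintype ι] [DecidableEq ι] (A : ι → Type u)
    [∀ i, AddCommGroup (A i)] [∀ i, Module R (A i)] (B : Type u) [AddCommGroup B] [Module R B]
    (e : B ≃ₗ[R] ∀ i, A i) (q : ℕ) : ExtRing R B q ≃ₗ[R] ∀ i, ExtRing R (A i) q :=
  LinearEquiv.ofLinearMap
    (LinearMap.pi fun i => extMap (e.symm.toLinearMap ∘ₗ LinearMap.single R A i) q)
    (∑ i, extMap (LinearMap.proj i ∘ₗ e.toLinearMap) q ∘ₗ LinearMap.proj i)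
    (by
      refine LinearMap.ext fun ξ => funext fun i => ?_
      simp only [LinearMap.comp_apply, LinearMap.pi_apply, LinearMap.sum_apply, map_sum,
        LinearMap.proj_apply, LinearMap.id_apply]
      rw [Finset.sum_eq_single i, ← extMap_comp]
      · refine Eq.trans ?_ (extMap_id q (ξ i))
        congr 2
        ext x
        simp
      · intro j _ hj
        rw [← extMap_comp]
        refine Eq.trans ?_ (extMap_zero (M₁ := A i) q (ξ j))
        congr 2
        ext x
        simp [hj]
      · simp)
    (by
      refine LinearMap.ext fun ξ => ?_
      simp only [LinearMap.comp_apply, LinearMap.pi_apply, LinearMap.sum_apply,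
        LinearMap.proj_apply, LinearMap.id_apply]
      simp_rw [← extMap_comp]
      rw [← extMap_sum]
      refine Eq.trans ?_ (extMap_id q ξ)
      congr 2
      ext x
      apply e.injective
      simp [LinearMap.sum_apply, Finset.univ_sum_single])

/-- A sequence `0 → M₁ → M₂ → M₃ → 0` as a short complex. -/
abbrev shortComplexOf (f : M₁ →ₗ[R] M₂) (g : M₂ →ₗ[R] M₃) (h : g ∘ₗ f = 0) :
    ShortComplex (ModuleCat.{u} R) :=
  ShortComplex.mk (ModuleCat.ofHom f) (ModuleCat.ofHom g) (by
    rw [← ModuleCat.ofHom_comp, h]; rfl)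

theorem shortExact_shortComplexOf {f : M₁ →ₗ[R] M₂} {g : M₂ →ₗ[R] M₃}
    (hf : Function.Injective f) (hg : Function.Surjective g) (h : Function.Exact f g) :
    (shortComplexOf f g h.linearMap_comp_eq_zero).ShortExact := by
  have := (ModuleCat.mono_iff_injective (ModuleCat.ofHom f)).2 hf
  have := (ModuleCat.epi_iff_surjective (ModuleCat.ofHom g)).2 hg
  exact ⟨(ShortComplex.ShortExact.moduleCat_exact_iff_function_exact _).2 h⟩

/-- The connecting map of the long exact sequence of `Ext_R(-, R)`. -/
def extConn {f : M₁ →ₗ[R] M₂} {g : M₂ →ₗ[R] M₃} (hf : Function.Injective f)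
    (hg : Function.Surjective g) (h : Function.Exact f g) (q : ℕ) :
    ExtRing R M₁ q →ₗ[R] ExtRing R M₃ (q + 1) :=
  (shortExact_shortComplexOf hf hg h).extClass.precompOfLinear R _ (add_comm 1 q)

section LES

variable {f : M₁ →ₗ[R] M₂} {g : M₂ →ₗ[R] M₃} (hf : Function.Injective f)
    (hg : Function.Surjective g) (h : Function.Exact f g)

include hf hg h

theorem exact_extMap_extMap (q : ℕ) : Function.Exact (extMap g q) (extMap f q) := by
  intro ξ
  refine ⟨fun hξ => Ext.contravariant_sequence_exact₂ (shortExact_shortComplexOf hf hg h) _ ξ hξ,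
    ?_⟩
  rintro ⟨η, rfl⟩
  rw [← extMap_comp, h.linearMap_comp_eq_zero, extMap_zero]

theorem exact_extMap_extConn (q : ℕ) :
    Function.Exact (extMap f q) (extConn hf hg h q) := by
  intro ξ
  refine ⟨fun hξ => Ext.contravariant_sequence_exact₁ (shortExact_shortComplexOf hf hg h) _ ξ
    (add_comm 1 q) hξ, ?_⟩
  rintro ⟨η, rfl⟩
  exact (shortExact_shortComplexOf hf hg h).extClass_comp_assoc η (h := add_comm 1 q)

theorem exact_extConn_extMap (q : ℕ) :
    Function.Exact (extConn hf hg h q) (extMap g (q + 1)) := by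
  intro ξ
  refine ⟨fun hξ => Ext.contravariant_sequence_exact₃ (shortExact_shortComplexOf hf hg h) _ ξ
    hξ (add_comm 1 q), ?_⟩
  rintro ⟨η, rfl⟩
  exact (shortExact_shortComplexOf hf hg h).comp_extClass_assoc η (add_comm 1 q)

/-- The connecting map is composition with the extension class, and an endomorphism of the short
exact sequence equates the two ways of composing with that class. This carries the action of all
translations along when the degree goes up, so that the duality step can be iterated. -/
theorem extConn_naturality {T₁ : M₁ →ₗ[R] M₁} {T₂ : M₂ →ₗ[R] M₂} {T₃ : M₃ →ₗ[R] M₃}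
    (h₁₂ : T₂ ∘ₗ f = f ∘ₗ T₁) (h₂₃ : T₃ ∘ₗ g = g ∘ₗ T₂) (q : ℕ) (ξ : ExtRing R M₁ q) :
    extConn hf hg h q (extMap T₁ q ξ) = extMap T₃ (q + 1) (extConn hf hg h q ξ) := by
  let S := shortExact_shortComplexOf hf hg h
  let φ : shortComplexOf f g h.linearMap_comp_eq_zero ⟶
      shortComplexOf f g h.linearMap_comp_eq_zero :=
    { τ₁ := ModuleCat.ofHom T₁
      τ₂ := ModuleCat.ofHom T₂
      τ₃ := ModuleCat.ofHom T₃
      comm₁₂ := by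
        change ModuleCat.ofHom _ ≫ ModuleCat.ofHom _ = ModuleCat.ofHom _ ≫ ModuleCat.ofHom _
        rw [← ModuleCat.ofHom_comp, ← ModuleCat.ofHom_comp, h₁₂]
      comm₂₃ := by
        change ModuleCat.ofHom _ ≫ ModuleCat.ofHom _ = ModuleCat.ofHom _ ≫ ModuleCat.ofHom _
        rw [← ModuleCat.ofHom_comp, ← ModuleCat.ofHom_comp, h₂₃] }
  have key := ShortComplex.ShortExact.extClass_naturality S S φ
  change S.extClass.comp ((Ext.mk₀ (ModuleCat.ofHom T₁)).comp ξ (zero_add q)) (add_comm 1 q) =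
    (Ext.mk₀ (ModuleCat.ofHom T₃)).comp (S.extClass.comp ξ (add_comm 1 q)) (zero_add (q + 1))
  rw [← Ext.comp_assoc _ _ _ (add_zero 1) (zero_add q) (by omega),
    ← Ext.comp_assoc _ _ _ (zero_add 1) (add_comm 1 q) (by omega)]
  exact congrArg (fun z => Ext.comp z ξ (add_comm 1 q)) key

end LES

/-! ### Modules with a single nonzero Ext group. -/

section Duality

variable {ι : Type*} {N N' M' : Type u} [AddCommGroup N] [Module R N] [AddCommGroup M']
  [Module R M'] [AddCommGroup N'] [Module R N']

/-- `Ext^q_R(M, R)` vanishes for `q ≠ j` and `Ext^j_R(M, R)` is isomorphic to `N`, in such a way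
that the endomorphisms `T i` of `M` correspond to the endomorphisms `T' i` of `N`. -/
structure IsExtDual (M N : Type u) [AddCommGroup M] [Module R M] [AddCommGroup N] [Module R N]
    (j : ℕ) (T : ι → Module.End R M) (T' : ι → Module.End R N) : Prop where
  subsingleton : ∀ q, q ≠ j → Subsingleton (ExtRing R M q)
  exists_equiv : ∃ α : ExtRing R M j ≃ₗ[R] N, ∀ i ξ, α (extMap (T i) j ξ) = T' i (α ξ)

/-- Duality passes to the cokernels of corresponding injective endomorphisms, with a shift of the
degree. -/
theorem IsExtDual.quotient {j : ℕ} {T : ι → Module.End R M} {T' : ι → Module.End R N}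
    (D : IsExtDual M N j T T') {S : ι → Module.End R M'} {S' : ι → Module.End R N'} (i₀ : ι)
    {g : M →ₗ[R] M'} {g' : N →ₗ[R] N'}
    (hT : ∀ i, T i ∘ₗ T i₀ = T i₀ ∘ₗ T i)
    (hinj : Function.Injective (T i₀ - LinearMap.id : M →ₗ[R] M))
    (hsurj : Function.Surjective g)
    (hex : Function.Exact (T i₀ - LinearMap.id : M →ₗ[R] M) g)
    (hinj' : Function.Injective (T' i₀ - LinearMap.id : N →ₗ[R] N))
    (hsurj' : Function.Surjective g')
    (hex' : Function.Exact (T' i₀ - LinearMap.id : N →ₗ[R] N) g')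
    (hg : ∀ i, S i ∘ₗ g = g ∘ₗ T i) (hg' : ∀ i, S' i ∘ₗ g' = g' ∘ₗ T' i) :
    IsExtDual M' N' (j + 1) S S' := by
  obtain ⟨α, hα⟩ := D.exists_equiv
  set f : M →ₗ[R] M := T i₀ - LinearMap.id with hf
  have hαf (ξ : ExtRing R M j) : α (extMap f j ξ) = (T' i₀ - LinearMap.id : N →ₗ[R] N) (α ξ) := by
    rw [hf, extMap_sub, extMap_id, map_sub, hα]
    rfl
  have hfinj : Function.Injective (extMap f j) := fun x y hxy => by
    apply α.injective
    apply hinj'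
    rw [← hαf, ← hαf, hxy]
  refine ⟨fun q hq => subsingleton_of_forall_eq 0 fun ξ => ?_, ?_⟩
  -- No connecting map ends in degree 0; there injectivity of Hom along a surjection replaces
  -- exactness.
  · obtain rfl | ⟨q, rfl⟩ : q = 0 ∨ ∃ q', q = q' + 1 := by
      rcases q with _ | q
      · exact Or.inl rfl
      · exact Or.inr ⟨q, rfl⟩
    · have h0 : extMap g 0 ξ = 0 := by
        by_cases hj : j = 0
        · subst hj
          apply hfinj
          rw [map_zero]
          exact (exact_extMap_extMap hinj hsurj hex 0).apply_apply_eq_zero ξ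
        · have := D.subsingleton 0 (Ne.symm hj)
          exact Subsingleton.elim _ _
      rw [← map_zero (extMap g 0)] at h0
      exact Ext.precomp_mk₀_injective_of_epi (hg := (ModuleCat.epi_iff_surjective _).2 hsurj)
        _ (ModuleCat.ofHom g) h0
    · have hqj : q ≠ j := by omega
      have := D.subsingleton q hqj
      have h0 : extMap g (q + 1) ξ = 0 := by
        by_cases hj : j = q + 1
        · subst hj
          apply hfinj
          rw [map_zero]
          exact (exact_extMap_extMap hinj hsurj hex _).apply_apply_eq_zero ξ
        · have := D.subsingleton (q + 1) (Ne.symm hj)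
          exact Subsingleton.elim _ _
      obtain ⟨η, rfl⟩ := (exact_extConn_extMap hinj hsurj hex q ξ).1 h0
      rw [Subsingleton.elim η 0, map_zero]
  -- Since Ext in degree j + 1 of M vanishes, δ is surjective. Its kernel is the image of `extMap f
  -- j`, which α carries to the range of T' i₀ - 1, that is, to the kernel of g'.
  · have := D.subsingleton (j + 1) (by omega)
    set δ := extConn hinj hsurj hex j
    have hδ : Function.Surjective δ := fun ξ =>
      (exact_extConn_extMap hinj hsurj hex j ξ).1 (Subsingleton.elim _ _)
    have hker : LinearMap.ker δ = LinearMap.ker (g' ∘ₗ α.toLinearMap) := by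
      ext ξ
      rw [LinearMap.mem_ker, LinearMap.mem_ker, exact_extMap_extConn hinj hsurj hex j ξ,
        LinearMap.comp_apply, LinearEquiv.coe_coe, hex' (α ξ)]
      constructor
      · rintro ⟨η, rfl⟩
        exact ⟨α η, (hαf η).symm⟩
      · rintro ⟨y, hy⟩
        refine ⟨α.symm y, α.injective ?_⟩
        rw [hαf, α.apply_symm_apply, hy]
    let β : ExtRing R M' (j + 1) ≃ₗ[R] N' :=
      (δ.quotKerEquivOfSurjective hδ).symm.trans
        ((Submodule.quotEquivOfEq _ _ hker).trans
          ((g' ∘ₗ α.toLinearMap).quotKerEquivOfSurjective (hsurj'.comp α.surjective)))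
    have hβ (ξ) : β (δ ξ) = g' (α ξ) := by
      have : (δ.quotKerEquivOfSurjective hδ).symm (δ ξ) = Submodule.Quotient.mk ξ := by
        rw [LinearEquiv.symm_apply_eq]
        rfl
      simp only [β, LinearEquiv.trans_apply, this]
      rfl
    refine ⟨β, fun i ξ => ?_⟩
    obtain ⟨η, rfl⟩ := hδ ξ
    rw [← extConn_naturality hinj hsurj hex (T₂ := T i) (T₁ := T i) ?_ (hg i), hβ, hβ, hα]
    · exact (LinearMap.congr_fun (hg' i) (α η)).symm
    · rw [hf, LinearMap.comp_sub, LinearMap.sub_comp, hT, LinearMap.comp_id, LinearMap.id_comp]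

end Duality

end ExtRing

end

end DPV

namespace DPV

noncomputable section

/-! ### Characters and linearity over the character ring. -/

section Characters

variable {Γ : Type u} [AddCommGroup Γ]

/-- The character `γ` as an element of the character ring. -/
def chr (γ : Γ) : CharRing Γ := AddMonoidAlgebra.single γ 1

theorem chr_add (a b : Γ) : chr (a + b) = chr a * chr b := by
  simp [chr, AddMonoidAlgebra.single_mul_single]

theorem chr_zero : chr (0 : Γ) = 1 := rfl

theorem single_eq_smul_chr (γ : Γ) (c : ℤ) :
    (AddMonoidAlgebra.single γ c : CharRing Γ) = c • chr γ := by
  rw [chr, AddMonoidAlgebra.smul_single, smul_eq_mul, mul_one]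

theorem nabla_eq (a : Γ) : nabla a = 1 - chr a := rfl

theorem chr_smul_apply (a : Γ) (f : FunSpace Γ) (x : Γ) :
    (chr a • f : FunSpace Γ) x = f (x - a) := by
  rw [chr, single_smul_apply, one_mul]

section Modules

variable {M N : Type*} [AddCommGroup M] [Module (CharRing Γ) M] [AddCommGroup N]
  [Module (CharRing Γ) N]

theorem chr_smul_chr_smul (a b : Γ) (m : M) : chr a • chr b • m = chr (a + b) • m := by
  rw [chr_add, mul_smul]

theorem chr_smul_neg_smul (a : Γ) (m : M) : chr a • chr (-a) • m = m := by
  rw [chr_smul_chr_smul, add_neg_cancel, chr_zero, one_smul]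

theorem chr_neg_smul_smul (a : Γ) (m : M) : chr (-a) • chr a • m = m := by
  rw [chr_smul_chr_smul, neg_add_cancel, chr_zero, one_smul]

/-- Additive maps commuting with the characters are linear over the character ring. -/
def linearOfChr (f : M →+ N) (h : ∀ (γ : Γ) (m : M), f (chr γ • m) = chr γ • f m) :
    M →ₗ[CharRing Γ] N where
  toFun := f
  map_add' := map_add f
  map_smul' r m := by
    rw [RingHom.id_apply]
    induction r using AddMonoidAlgebra.induction_linear with
    | zero => simp
    | add p q hp hq => rw [add_smul, add_smul, map_add, hp, hq]
    | single γ c => rw [single_eq_smul_chr, smul_assoc, smul_assoc, map_zsmul, h]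

end Modules

end Characters

/-! ### The integral dual of a module. -/

section Dual

variable {R : Type u} [CommRing R] (B : Type u) [AddCommGroup B] [Module R B]

/-- The `ℤ`-dual of an `R`-module `B`. -/
def IntDual : Type u := B →ₗ[ℤ] ℤ

instance : AddCommGroup (IntDual B) := inferInstanceAs (AddCommGroup (B →ₗ[ℤ] ℤ))

instance : FunLike (IntDual B) B ℤ := inferInstanceAs (FunLike (B →ₗ[ℤ] ℤ) B ℤ)

instance : AddMonoidHomClass (IntDual B) B ℤ :=
  inferInstanceAs (AddMonoidHomClass (B →ₗ[ℤ] ℤ) B ℤ)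

variable {B}

theorem IntDual.ext {φ ψ : IntDual B} (h : ∀ b, φ b = ψ b) : φ = ψ := DFunLike.ext _ _ h

theorem IntDual.add_apply (φ ψ : IntDual B) (b : B) : (φ + ψ) b = φ b + ψ b := rfl

theorem IntDual.zero_apply (b : B) : (0 : IntDual B) b = 0 := rfl

/-- The transpose of the multiplication by `r`. -/
def IntDual.smul (r : R) (φ : IntDual B) : IntDual B :=
  LinearMap.comp (φ : B →ₗ[ℤ] ℤ) (DistribSMul.toAddMonoidHom B r).toIntLinearMap

instance : Module R (IntDual B) where
  smul := IntDual.smul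
  one_smul φ := IntDual.ext fun b => congrArg φ (one_smul R b)
  mul_smul r s φ := IntDual.ext fun b => congrArg φ ((congrArg (· • b) (mul_comm r s)).trans
    (mul_smul s r b))
  smul_zero _ := rfl
  smul_add _ _ _ := rfl
  add_smul r s φ := IntDual.ext fun b => (congrArg φ (add_smul r s b)).trans (map_add φ _ _)
  zero_smul φ := IntDual.ext fun b => (congrArg φ (zero_smul R b)).trans (map_zero φ)

theorem IntDual.smul_apply (r : R) (φ : IntDual B) (b : B) : (r • φ) b = φ (r • b) := rfl

end Dual

/-! ### Twisted modules over a quotient of Γ, and their translations. -/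

section Twisted

variable {Γ : Type u} [AddCommGroup Γ] {Λ Λ' : Type u} [AddCommGroup Λ] [AddCommGroup Λ']

/-- Finitely supported functions from a quotient `Λ` of `Γ` to an `R(G)`-module `B`, on which
`Γ` acts diagonally. -/
def Twisted (_ : Γ →+ Λ) (B : Type u) [AddCommGroup B] : Type u := Λ →₀ B

namespace Twisted

variable (q : Γ →+ Λ) {q' : Γ →+ Λ'} (B : Type u) [AddCommGroup B]

instance : AddCommGroup (Twisted q B) := inferInstanceAs (AddCommGroup (Λ →₀ B))

instance : FunLike (Twisted q B) Λ B := inferInstanceAs (FunLike (Λ →₀ B) Λ B)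

variable {B}

/-- The function supported at a single point. -/
def single (l : Λ) : B →+ Twisted q B := Finsupp.singleAddHom l

variable {q}

theorem ext {F F' : Twisted q B} (h : ∀ l, F l = F' l) : F = F' := DFunLike.ext _ _ h

theorem add_apply (F F' : Twisted q B) (l : Λ) : (F + F') l = F l + F' l := rfl

theorem zero_apply (l : Λ) : (0 : Twisted q B) l = 0 := rfl

theorem sub_apply (F F' : Twisted q B) (l : Λ) : (F - F') l = F l - F' l :=
  Finsupp.sub_apply F F' l

theorem single_apply [DecidableEq Λ] (l l' : Λ) (b : B) :
    single q l b l' = if l = l' then b else 0 := Finsupp.single_apply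

theorem finite_support (F : Twisted q B) : {l | F l ≠ 0}.Finite := Finsupp.hasFiniteSupport F

/-- A finitely supported function as an element of `Twisted q B`. -/
def ofFun (f : Λ → B) (h : {l | f l ≠ 0}.Finite) : Twisted q B := Finsupp.ofSupportFinite f h

theorem ofFun_apply (f : Λ → B) (h : {l | f l ≠ 0}.Finite) (l : Λ) :
    (ofFun f h : Twisted q B) l = f l := rfl

theorem induction_on {P : Twisted q B → Prop} (F : Twisted q B) (zero : P 0)
    (add : ∀ F F', P F → P F' → P (F + F')) (sing : ∀ l b, P (single q l b)) : P F :=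
  Finsupp.induction_linear (motive := P) F zero (fun _ _ => add _ _) sing

theorem hom_ext {N : Type*} [AddCommGroup N] {f g : Twisted q B →+ N}
    (h : ∀ l b, f (single q l b) = g (single q l b)) : f = g :=
  Finsupp.addHom_ext (f := f) (g := g) h

/-- Additive maps out of `Twisted q B`. -/
def lift {N : Type*} [AddCommGroup N] (f : Λ → B →+ N) : Twisted q B →+ N :=
  Finsupp.liftAddHom f

theorem lift_single {N : Type*} [AddCommGroup N] (f : Λ → B →+ N) (l : Λ) (b : B) :
    lift f (single q l b) = f l b := Finsupp.liftAddHom_apply_single f l b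

variable [Module (CharRing Γ) B]

variable (q B) in
/-- The diagonal action of an element of `Γ`. -/
def act (γ : Γ) : Module.End ℤ (Twisted q B) :=
  (lift fun l => (single q (q γ + l)).comp
    (DistribSMul.toAddMonoidHom B (chr γ))).toIntLinearMap

theorem act_single (γ : Γ) (l : Λ) (b : B) :
    act q B γ (single q l b) = single q (q γ + l) (chr γ • b) :=
  lift_single _ _ _

variable (q B) in
/-- The diagonal action of `Γ`. -/
def actHom : Multiplicative Γ →* Module.End ℤ (Twisted q B) where
  toFun γ := act q B γ.toAdd
  map_one' := by
    refine LinearMap.ext fun F => ?_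
    refine DFunLike.congr_fun (f := (act q B 0).toAddMonoidHom) (g := AddMonoidHom.id _)
      (hom_ext fun l b => ?_) F
    change act q B 0 (single q l b) = _
    rw [act_single, map_zero, zero_add, chr_zero, one_smul]
    rfl
  map_mul' a b := by
    refine LinearMap.ext fun F => ?_
    refine DFunLike.congr_fun (f := (act q B (a.toAdd + b.toAdd)).toAddMonoidHom)
      (g := (act q B a.toAdd * act q B b.toAdd).toAddMonoidHom) (hom_ext fun l c => ?_) F
    change act q B (a.toAdd + b.toAdd) (single q l c) =
      act q B a.toAdd (act q B b.toAdd (single q l c))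
    rw [act_single, act_single, act_single, map_add, add_assoc, chr_smul_chr_smul]

instance : Module (CharRing Γ) (Twisted q B) :=
  Module.compHom (Twisted q B)
    (AddMonoidAlgebra.lift ℤ (Module.End ℤ (Twisted q B)) Γ (actHom q B)).toRingHom

theorem chr_smul_single (γ : Γ) (l : Λ) (b : B) :
    chr γ • single q l b = single q (q γ + l) (chr γ • b) := by
  change (AddMonoidAlgebra.lift ℤ (Module.End ℤ (Twisted q B)) Γ (actHom q B))
    (AddMonoidAlgebra.single γ 1) (single q l b) = _
  rw [AddMonoidAlgebra.lift_single, one_smul]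
  exact act_single γ l b

theorem chr_smul_apply (γ : Γ) (F : Twisted q B) (l : Λ) :
    (chr γ • F) l = chr γ • F (l - q γ) := by
  classical
  induction F using induction_on with
  | zero => simp [zero_apply]
  | add F F' h h' => rw [smul_add, add_apply, h, h', add_apply, smul_add]
  | sing l' b =>
    rw [chr_smul_single, single_apply, single_apply]
    by_cases hl : q γ + l' = l
    · rw [if_pos hl, if_pos (by rw [← hl]; abel)]
    · rw [if_neg hl, if_neg (by rintro rfl; apply hl; abel), smul_zero]

/-- Equivariant maps out of `Twisted q B`. -/
def liftLinear {N : Type*} [AddCommGroup N] [Module (CharRing Γ) N] (f : Λ → B →+ N)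
    (h : ∀ (γ : Γ) l b, f (q γ + l) (chr γ • b) = chr γ • f l b) :
    Twisted q B →ₗ[CharRing Γ] N :=
  linearOfChr (lift f) fun γ F => by
    induction F using induction_on with
    | zero => simp
    | add F F' h h' => rw [smul_add, map_add, h, h', map_add, smul_add]
    | sing l b => rw [chr_smul_single, lift_single, lift_single, h]

theorem liftLinear_single {N : Type*} [AddCommGroup N] [Module (CharRing Γ) N] (f : Λ → B →+ N)
    (h : ∀ (γ : Γ) l b, f (q γ + l) (chr γ • b) = chr γ • f l b) (l : Λ) (b : B) :
    liftLinear f h (single q l b) = f l b := lift_single _ _ _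

theorem linear_ext {N : Type*} [AddCommGroup N] [Module (CharRing Γ) N]
    {f g : Twisted q B →ₗ[CharRing Γ] N} (h : ∀ l b, f (single q l b) = g (single q l b)) :
    f = g :=
  LinearMap.ext fun F => DFunLike.congr_fun (f := f.toAddMonoidHom) (g := g.toAddMonoidHom)
    (hom_ext h) F

variable (q B) in
/-- Translation of the argument by the image of `μ : Γ`. -/
def shift (μ : Γ) : Module.End (CharRing Γ) (Twisted q B) :=
  liftLinear (fun l => single q (q μ + l)) fun γ l b => by
    rw [chr_smul_single, ← add_assoc, ← add_assoc, add_comm (q μ)]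

theorem shift_single (μ : Γ) (l : Λ) (b : B) :
    shift q B μ (single q l b) = single q (q μ + l) b := liftLinear_single _ _ _ _

theorem shift_apply (μ : Γ) (F : Twisted q B) (l : Λ) :
    shift q B μ F l = F (l - q μ) := by
  classical
  induction F using induction_on with
  | zero => simp [zero_apply]
  | add F F' h h' => rw [map_add, add_apply, h, h', add_apply]
  | sing l' b =>
    rw [shift_single, single_apply, single_apply]
    by_cases hl : q μ + l' = l
    · rw [if_pos hl, if_pos (by rw [← hl]; abel)]
    · rw [if_neg hl, if_neg (by rintro rfl; apply hl; abel)]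

theorem shift_comm (μ ν : Γ) : shift q B μ ∘ₗ shift q B ν = shift q B ν ∘ₗ shift q B μ :=
  linear_ext fun l b => by
    simp only [LinearMap.comp_apply, shift_single]
    rw [← add_assoc, ← add_assoc, add_comm (q μ)]

variable (B) in
/-- Summation along the fibres of a further quotient. -/
def proj (p : Λ →+ Λ') (hp : p.comp q = q') : Twisted q B →ₗ[CharRing Γ] Twisted q' B :=
  liftLinear (fun l => single q' (p l)) fun γ l b => by
    rw [chr_smul_single, map_add, ← hp]
    rfl

theorem proj_single (p : Λ →+ Λ') (hp : p.comp q = q') (l : Λ) (b : B) :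
    proj B p hp (single q l b) = single q' (p l) b := liftLinear_single _ _ _ _

theorem shift_comp_proj (p : Λ →+ Λ') (hp : p.comp q = q') (μ : Γ) :
    shift q' B μ ∘ₗ proj B p hp = proj B p hp ∘ₗ shift q B μ :=
  linear_ext fun l b => by
    simp only [LinearMap.comp_apply, shift_single, proj_single]
    rw [map_add, ← hp]
    rfl

theorem proj_surjective (p : Λ →+ Λ') (hp : p.comp q = q') (hs : Function.Surjective p) :
    Function.Surjective (proj B p hp) := by
  intro F
  induction F using induction_on with
  | zero => exact ⟨0, map_zero _⟩
  | add F F' h h' =>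
    obtain ⟨x, rfl⟩ := h
    obtain ⟨y, rfl⟩ := h'
    exact ⟨x + y, map_add _ _ _⟩
  | sing l b =>
    obtain ⟨l, rfl⟩ := hs l
    exact ⟨single q l b, proj_single p hp l b⟩

/-- A function invariant under translation by an element of infinite order repeats each nonzero
value infinitely often, which finite support forbids. -/
theorem shift_sub_id_injective (e : Γ) (he : ∀ n : ℕ, n • q e = 0 → n = 0) :
    Function.Injective (shift q B e - LinearMap.id : Twisted q B →ₗ[CharRing Γ] Twisted q B) := by
  rw [injective_iff_map_eq_zero]
  intro F hF
  have h1 (l : Λ) : F (l - q e) = F l := by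
    rw [← shift_apply, ← sub_eq_zero, ← sub_apply]
    exact DFunLike.congr_fun hF l
  have h2 (l : Λ) (n : ℕ) : F (l - n • q e) = F l := by
    induction n with
    | zero => rw [zero_smul, sub_zero]
    | succ n ih => rw [succ_nsmul, ← sub_sub, h1, ih]
  refine ext fun l => ?_
  by_contra hl
  refine Set.infinite_of_injective_forall_mem (f := fun n : ℕ => l - n • q e) ?_ ?_
    F.finite_support
  · intro m n hmn
    have hmn' : m • q e = n • q e := sub_right_injective hmn
    rcases le_total m n with h | h
    · have := he (n - m) (by rw [sub_nsmul _ h, hmn', add_neg_cancel])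
      omega
    · have := he (m - n) (by rw [sub_nsmul _ h, hmn', add_neg_cancel])
      omega
  · intro n
    change F (l - n • q e) ≠ 0
    rw [h2]
    exact hl

/-- Modulo the image of the translation minus one, a value may be moved freely along the cosets of
the cyclic kernel of `p`. Moving every value to a chosen representative of its coset shows that F is
congruent to a function depending only on its fibre sums. -/
theorem shift_sub_id_exact (p : Λ →+ Λ') (hp : p.comp q = q') (hs : Function.Surjective p)
    (e : Γ) (hker : ∀ l, p l = 0 ↔ ∃ n : ℤ, l = n • q e) :
    Function.Exact (shift q B e - LinearMap.id : Twisted q B →ₗ[CharRing Γ] Twisted q B)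
      (proj B p hp) := by
  set D : Twisted q B →ₗ[CharRing Γ] Twisted q B := shift q B e - LinearMap.id with hD
  have hD1 (l : Λ) (b : B) : single q (q e + l) b - single q l b ∈ LinearMap.range D :=
    ⟨single q l b, by rw [hD, LinearMap.sub_apply, shift_single]; rfl⟩
  have hD2 (l : Λ) (b : B) (n : ℤ) :
      single q (n • q e + l) b - single q l b ∈ LinearMap.range D := by
    induction n using Int.induction_on with
    | zero => simp
    | succ n ih =>
      have := add_mem ih (hD1 ((n : ℤ) • q e + l) b)
      convert this using 1
      rw [add_smul, one_smul, add_comm ((n : ℤ) • q e) (q e), add_assoc]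
      abel
    | pred n ih =>
      have := sub_mem ih (hD1 ((-(n : ℤ) - 1) • q e + l) b)
      convert this using 1
      rw [sub_smul, one_smul]
      have : q e + (-(n : ℤ) • q e - q e + l) = -(n : ℤ) • q e + l := by abel
      rw [this]
      abel
  obtain ⟨σ, hσ⟩ := hs.hasRightInverse
  let S : Twisted q' B →+ Twisted q B := lift fun l => single q (σ l)
  have hS (F : Twisted q B) : F - S (proj B p hp F) ∈ LinearMap.range D := by
    induction F using induction_on with
    | zero => simp
    | add F F' h h' =>
      rw [map_add, map_add, add_sub_add_comm]
      exact add_mem h h'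
    | sing l b =>
      have h1 : S (proj B p hp (single q l b)) = single q (σ (p l)) b := by
        rw [proj_single]
        exact lift_single _ _ _
      obtain ⟨n, hn⟩ := (hker (l - σ (p l))).1 (by rw [map_sub, hσ, sub_self])
      rw [h1]
      have := hD2 (σ (p l)) b n
      rwa [← hn, sub_add_cancel] at this
  intro F
  constructor
  · intro hF
    have := hS F
    rwa [hF, map_zero, sub_zero] at this
  · rintro ⟨F, rfl⟩
    refine DFunLike.congr_fun (f := (proj B p hp ∘ₗ D)) (g := 0) (linear_ext fun l b => ?_) F
    rw [LinearMap.comp_apply, hD, LinearMap.sub_apply, shift_single, map_sub, LinearMap.id_apply,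
      proj_single, proj_single, map_add, (hker (q e)).2 ⟨1, (one_smul _ _).symm⟩, zero_add,
      sub_self]
    rfl

/-- The step from `Λ` to its quotient by a cyclic subgroup. -/
theorem isExtDual_step {C : Type u} [AddCommGroup C] [Module (CharRing Γ) C] {j : ℕ}
    (D : IsExtDual (Twisted q C) (Twisted q B) j (shift q C) (shift q B))
    (p : Λ →+ Λ') (hp : p.comp q = q') (hs : Function.Surjective p)
    (e : Γ) (hker : ∀ l, p l = 0 ↔ ∃ n : ℤ, l = n • q e) (he : ∀ n : ℕ, n • q e = 0 → n = 0) :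
    IsExtDual (Twisted q' C) (Twisted q' B) (j + 1) (shift q' C) (shift q' B) :=
  D.quotient e (fun i => shift_comm i e) (shift_sub_id_injective e he)
    (proj_surjective p hp hs) (shift_sub_id_exact p hp hs e hker) (shift_sub_id_injective e he)
    (proj_surjective p hp hs) (shift_sub_id_exact p hp hs e hker)
    (fun i => shift_comp_proj p hp i) (fun i => shift_comp_proj p hp i)

end Twisted

end Twisted

end

end DPV

namespace DPV

noncomputable section

theorem chr_mul_single {Γ : Type u} [AddCommGroup Γ] (γ a : Γ) (c : ℤ) :
    chr γ * AddMonoidAlgebra.single a c = AddMonoidAlgebra.single (γ + a) c := by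
  rw [chr, AddMonoidAlgebra.single_mul_single, one_mul]

theorem IntDual.separating {B : Type u} [AddCommGroup B] [Module.Free ℤ B] {b : B}
    (h : ∀ φ : IntDual B, φ b = 0) : b = 0 :=
  (Module.forall_dual_apply_eq_zero_iff ℤ b).1 h

/-! ### Duality of twisted modules: the projective case and cyclic quotients. -/

namespace Twisted

variable {Γ : Type u} [AddCommGroup Γ] {Λ : Type u} [AddCommGroup Λ]
variable {q : Γ →+ Λ} (r : Λ →+ Γ) {B : Type u} [AddCommGroup B] [Module (CharRing Γ) B]
variable {N : Type*} [AddCommGroup N] [Module (CharRing Γ) N]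

section Free

variable (hrq : ∀ γ, r (q γ) = γ) (hqr : ∀ l, q (r l) = l)

include hqr in
theorem single_eq_chr_smul (l : Λ) (b : B) :
    single q l b = chr (r l) • single q 0 (chr (-r l) • b) := by
  rw [chr_smul_single, chr_smul_neg_smul, hqr, add_zero]

include hqr in
theorem linear_ext_zero {f g : Twisted q B →ₗ[CharRing Γ] N}
    (h : ∀ b, f (single q 0 b) = g (single q 0 b)) : f = g :=
  linear_ext fun l b => by rw [single_eq_chr_smul r hqr, f.map_smul, g.map_smul, h]

/-- If `q` is bijective then additive maps out of `B` extend to linear maps out of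
`Twisted q B`. -/
def extend (h : B →+ N) : Twisted q B →ₗ[CharRing Γ] N :=
  liftLinear (fun l => (DistribSMul.toAddMonoidHom N (chr (r l))).comp
    (h.comp (DistribSMul.toAddMonoidHom B (chr (-r l))))) fun γ l b => by
    change chr (r (q γ + l)) • h (chr (-r (q γ + l)) • chr γ • b) =
      chr γ • chr (r l) • h (chr (-r l) • b)
    rw [map_add, hrq, chr_smul_chr_smul, chr_smul_chr_smul]
    congr 4
    abel

theorem extend_single_zero (h : B →+ N) (b : B) :
    extend r hrq h (single q 0 b) = h b := by
  rw [extend, liftLinear_single]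
  change chr (r 0) • h (chr (-r 0) • b) = h b
  rw [map_zero, neg_zero, chr_zero, one_smul, one_smul]

include hrq hqr in
-- When q is bijective the module is induced from ℤ: linear maps out of it are additive maps out of
-- the fibre at 0, so lifting reduces to lifting over ℤ.
theorem projective [Module.Projective ℤ B] : Module.Projective (CharRing Γ) (Twisted q B) := by
  refine Module.Projective.of_lifting_property'' fun f hf => ?_
  obtain ⟨h, hh⟩ := Module.projective_lifting_property f.toAddMonoidHom.toIntLinearMap
    (single q 0 : B →+ Twisted q B).toIntLinearMap hf
  refine ⟨extend r hrq h.toAddMonoidHom, linear_ext_zero r hqr fun b => ?_⟩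
  rw [LinearMap.comp_apply, extend_single_zero]
  exact LinearMap.congr_fun hh b

/-- The kernel of the pairing between `Twisted q B` and `Twisted q (IntDual B)`. -/
def pairKernel (m : Λ) : B →+ IntDual B →+ CharRing Γ :=
  AddMonoidHom.mk' (fun b => AddMonoidHom.mk'
    (fun φ => AddMonoidAlgebra.single (r m) (φ (chr (-r m) • b)))
    fun φ ψ => by rw [IntDual.add_apply, AddMonoidAlgebra.single_add])
    fun b c => by
      ext φ : 1
      simp [smul_add, AddMonoidAlgebra.single_add]

theorem pairKernel_apply (m : Λ) (b : B) (φ : IntDual B) :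
    pairKernel r m b φ = AddMonoidAlgebra.single (r m) (φ (chr (-r m) • b)) := rfl

include hrq in
theorem pairKernel_smul_left (γ : Γ) (m : Λ) (b : B) (φ : IntDual B) :
    pairKernel r (q γ + m) (chr γ • b) φ = chr γ • pairKernel r m b φ := by
  rw [pairKernel_apply, pairKernel_apply, map_add, hrq, chr_smul_chr_smul, smul_eq_mul,
    chr_mul_single]
  congr 4
  abel

include hrq in
theorem pairKernel_smul_right (γ : Γ) (m : Λ) (b : B) (φ : IntDual B) :
    pairKernel r (q γ + m) b (chr γ • φ) = chr γ • pairKernel r m b φ := by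
  rw [← pairKernel_smul_left r hrq, pairKernel_apply, pairKernel_apply, IntDual.smul_apply,
    smul_comm]

/-- The partial pairing. -/
def pairAux : Twisted q B →+ (Λ → IntDual B →+ CharRing Γ) :=
  lift fun l' => AddMonoidHom.mk' (fun b l => pairKernel r (l + l') b) fun b c =>
    funext fun _ => map_add _ b c

theorem pairAux_single (l' l : Λ) (b : B) :
    pairAux r (single q l' b) l = pairKernel r (l + l') b := by
  rw [pairAux, lift_single]
  rfl

theorem pairAux_add (n n' : Twisted q B) (l : Λ) (φ : IntDual B) :
    pairAux r (n + n') l φ = pairAux r n l φ + pairAux r n' l φ := by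
  rw [map_add]
  rfl

include hrq in
theorem pairAux_smul_right (n : Twisted q B) (γ : Γ) (l : Λ) (φ : IntDual B) :
    pairAux r n (q γ + l) (chr γ • φ) = chr γ • pairAux r n l φ := by
  induction n using induction_on with
  | zero => simp
  | add n n' h h' => rw [pairAux_add, h, h', pairAux_add, smul_add]
  | sing l' b => rw [pairAux_single, pairAux_single, add_assoc, pairKernel_smul_right r hrq]

include hrq in
theorem pairAux_smul_left (n : Twisted q B) (γ : Γ) (l : Λ) (φ : IntDual B) :
    pairAux r (chr γ • n) l φ = chr γ • pairAux r n l φ := by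
  induction n using induction_on with
  | zero => simp
  | add n n' h h' => rw [smul_add, pairAux_add, h, h', pairAux_add, smul_add]
  | sing l' b =>
    rw [chr_smul_single, pairAux_single, pairAux_single, add_left_comm,
      pairKernel_smul_left r hrq]

/-- The pairing between `Twisted q B` and `Twisted q (IntDual B)`. -/
def pair : Twisted q B →ₗ[CharRing Γ] Twisted q (IntDual B) →ₗ[CharRing Γ] CharRing Γ :=
  linearOfChr (AddMonoidHom.mk'
    (fun n => liftLinear (pairAux r n) (pairAux_smul_right r hrq n))
    fun n n' => linear_ext fun l φ => by
      rw [LinearMap.add_apply, liftLinear_single, liftLinear_single, liftLinear_single,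
        pairAux_add])
    fun γ n => linear_ext fun l φ => by
      change liftLinear (pairAux r (chr γ • n)) (pairAux_smul_right r hrq _) (single q l φ) =
        chr γ • liftLinear (pairAux r n) (pairAux_smul_right r hrq _) (single q l φ)
      rw [liftLinear_single, liftLinear_single, pairAux_smul_left r hrq]

theorem pair_single_right (n : Twisted q B) (l : Λ) (φ : IntDual B) :
    pair r hrq n (single q l φ) = pairAux r n l φ :=
  liftLinear_single _ (pairAux_smul_right r hrq n) _ _

theorem pair_single (l' l : Λ) (b : B) (φ : IntDual B) :
    pair r hrq (single q l' b) (single q l φ) = pairKernel r (l + l') b φ := by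
  rw [pair_single_right, pairAux_single]

theorem pair_shift (μ : Γ) (n : Twisted q B) :
    pair r hrq (shift q B μ n) = pair r hrq n ∘ₗ shift q (IntDual B) μ :=
  linear_ext fun l φ => by
    rw [LinearMap.comp_apply, shift_single]
    induction n using induction_on with
    | zero => simp
    | add n n' h h' =>
      rw [map_add, map_add, LinearMap.add_apply, h, h', map_add, LinearMap.add_apply]
    | sing l' b =>
      rw [shift_single, pair_single, pair_single, add_left_comm, add_assoc]

include hqr in
-- Testing against elements supported at 0 reads off every value of n through the functionals on B.
-- Injectivity of the pairing then follows from separation by functionals, and surjectivity from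
-- biduality.
theorem coeff_pair (n : Twisted q B) (φ : IntDual B) (γ : Γ) :
    (pair r hrq n (single q 0 φ)).coeff γ = φ (chr (-γ) • n (q γ)) := by
  classical
  induction n using induction_on with
  | zero => simp [zero_apply]
  | add n n' h h' =>
    rw [map_add, LinearMap.add_apply, AddMonoidAlgebra.coeff_add, Finsupp.add_apply, h, h',
      add_apply, smul_add, map_add]
  | sing l b =>
    rw [pair_single, pairKernel_apply, zero_add, AddMonoidAlgebra.coeff_single,
      Finsupp.single_apply, single_apply]
    by_cases h : r l = γ
    · rw [if_pos h, if_pos (by rw [← h, hqr]), h]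
    · rw [if_neg h, if_neg (by rintro rfl; exact h (hrq γ)), smul_zero, map_zero]

variable [Module.Free ℤ B]

include hqr in
theorem pair_injective : Function.Injective (pair r hrq : Twisted q B →ₗ[CharRing Γ] _) := by
  rw [injective_iff_map_eq_zero]
  intro n hn
  refine ext fun l => ?_
  have : chr (-r l) • n l = 0 := IntDual.separating fun φ => by
    have := coeff_pair r hrq hqr n φ (r l)
    rw [hn, hqr] at this
    exact this.symm
  rw [← chr_smul_neg_smul (r l) (n l), this, smul_zero]
  rfl

variable [Module.Finite ℤ B]

include hqr in
-- Each coefficient of `h` on the fibre at 0 is an element of the bidual of B, hence a vector of B.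
-- Only finitely many of these vectors are nonzero because the dual of B is finitely generated.
theorem pair_surjective : Function.Surjective (pair r hrq : Twisted q B →ₗ[CharRing Γ] _) := by
  intro h
  let c₀ (γ : Γ) : IntDual B →+ ℤ := AddMonoidHom.mk' (fun φ => (h (single q 0 φ)).coeff γ)
    fun φ ψ => by rw [map_add, map_add, AddMonoidAlgebra.coeff_add, Finsupp.add_apply]
  let c (γ : Γ) : Module.Dual ℤ (Module.Dual ℤ B) :=
    AddMonoidHom.toIntLinearMap (M := Module.Dual ℤ B) (c₀ γ)
  let ν (γ : Γ) : B := (Module.evalEquiv ℤ B).symm (c γ)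
  have hν (γ : Γ) (φ : IntDual B) : φ (ν γ) = (h (single q 0 φ)).coeff γ := by
    have : Module.evalEquiv ℤ B (ν γ) = c γ := LinearEquiv.apply_symm_apply _ _
    exact LinearMap.congr_fun this φ
  obtain ⟨S, hS⟩ := (Module.Finite.fg_top : (⊤ : Submodule ℤ (Module.Dual ℤ B)).FG)
  have hfin : {γ | ν γ ≠ 0}.Finite := by
    refine Set.Finite.subset (S.finite_toSet.biUnion fun φ _ =>
      (h (single q 0 (φ : IntDual B))).coeff.hasFiniteSupport) fun γ hγ => ?_
    by_contra hc
    simp only [Set.mem_iUnion, not_exists] at hc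
    apply hγ
    have h0 : c γ = 0 := by
      refine LinearMap.ext_on (s := (S : Set (Module.Dual ℤ B))) hS fun φ hφ => ?_
      by_contra hne
      exact hc φ hφ hne
    change (Module.evalEquiv ℤ B).symm (c γ) = 0
    rw [h0, map_zero]
  -- The factor `chr (r l)` cancels the twist `chr (-γ)` in `coeff_pair`.
  refine ⟨ofFun (fun l => chr (r l) • ν (r l)) ?_, linear_ext_zero r hqr fun φ => ?_⟩
  · refine (hfin.image q).subset fun l hl => ⟨r l, ?_, hqr l⟩
    rintro h0
    exact hl (by rw [h0, smul_zero])
  · refine AddMonoidAlgebra.ext (Finsupp.ext fun γ => ?_)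
    rw [coeff_pair r hrq hqr, ofFun_apply, hrq, chr_neg_smul_smul, hν]

include hrq hqr in
-- Projectivity leaves only degree 0, where the pairing identifies Hom with `Twisted q B`;
-- translations are self-adjoint for this pairing.
theorem isExtDual_of_bijective :
    IsExtDual (Twisted q (IntDual B)) (Twisted q B) 0 (shift q (IntDual B)) (shift q B) := by
  have : Module.Projective ℤ (IntDual B) :=
    inferInstanceAs (Module.Projective ℤ (Module.Dual ℤ B))
  have := projective r hrq hqr (B := IntDual B)
  refine ⟨fun k hk => subsingleton_extRing_of_projective k hk, ?_⟩
  let β := LinearEquiv.ofBijective (pair r hrq : Twisted q B →ₗ[CharRing Γ] _)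
    ⟨pair_injective r hrq hqr, pair_surjective r hrq hqr⟩
  refine ⟨extZeroEquiv.trans β.symm, fun μ ξ => ?_⟩
  rw [LinearEquiv.trans_apply, LinearEquiv.trans_apply, extZeroEquiv_extMap,
    LinearEquiv.symm_apply_eq]
  refine Eq.trans ?_ (pair_shift r hrq μ _).symm
  congr 1
  exact (β.apply_symm_apply _).symm

end Free

/-- For linearly independent elements `v` of `Γ`, spanning `L`, the module of finitely supported
functions on `Γ ⧸ L` with values in the dual of `B` has only one nonzero Ext group. -/
theorem isExtDual_span [Module.Free ℤ B] [Module.Finite ℤ B] {k : ℕ} (v : Fin k → Γ)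
    (hv : LinearIndependent ℤ v) :
    IsExtDual (Twisted (Submodule.mkQ (Submodule.span ℤ (Set.range v))).toAddMonoidHom (IntDual B))
      (Twisted (Submodule.mkQ (Submodule.span ℤ (Set.range v))).toAddMonoidHom B) k
      (shift _ _) (shift _ _) := by
  induction k with
  | zero =>
    have h0 : Submodule.span ℤ (Set.range v) = ⊥ := by
      rw [Set.range_eq_empty, Submodule.span_empty]
    refine isExtDual_of_bijective (Submodule.quotEquivOfEqBot _ h0).toLinearMap.toAddMonoidHom
      (fun γ => ?_) (fun l => ?_)
    · exact Submodule.quotEquivOfEqBot_apply_mk _ h0 γ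
    · exact (Submodule.quotEquivOfEqBot _ h0).symm_apply_apply l
  | succ k ih =>
    have hle : Submodule.span ℤ (Set.range (v ∘ Fin.castSucc)) ≤
        Submodule.span ℤ (Set.range v) :=
      Submodule.span_mono (Set.range_comp_subset_range _ _)
    have hspan : Submodule.span ℤ (Set.range v) = Submodule.span ℤ {v (Fin.last k)} ⊔
        Submodule.span ℤ (Set.range (v ∘ Fin.castSucc)) := by
      rw [← Submodule.span_union]
      congr 1
      ext x
      simp only [Set.mem_range, Set.mem_union, Set.mem_singleton_iff, Function.comp_apply,
        Fin.exists_fin_succ']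
      grind
    -- Adding the last vector divides the previous quotient of Γ by one more infinite cyclic
    -- subgroup.
    refine isExtDual_step (ih (v ∘ Fin.castSucc) (hv.comp _ (Fin.castSucc_injective k)))
      (Submodule.factor hle).toAddMonoidHom ?_ (Submodule.factor_surjective hle)
      (v (Fin.last k)) (fun l => ?_) (fun n hn => ?_)
    · ext γ
      rfl
    · obtain ⟨x, rfl⟩ := Submodule.mkQ_surjective _ l
      change Submodule.Quotient.mk x = 0 ↔ _
      rw [Submodule.Quotient.mk_eq_zero, hspan, Submodule.mem_sup]
      constructor
      · rintro ⟨y, hy, z, hz, rfl⟩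
        obtain ⟨n, rfl⟩ := Submodule.mem_span_singleton.1 hy
        refine ⟨n, ?_⟩
        rw [map_add, map_smul]
        have : Submodule.mkQ (Submodule.span ℤ (Set.range (v ∘ Fin.castSucc))) z = 0 := by
          simpa using hz
        rw [this, add_zero]
        rfl
      · rintro ⟨n, hn⟩
        refine ⟨n • v (Fin.last k), Submodule.mem_span_singleton.2 ⟨n, rfl⟩,
          x - n • v (Fin.last k), ?_, by abel⟩
        rw [← Submodule.Quotient.mk_eq_zero, Submodule.Quotient.mk_sub, sub_eq_zero]
        exact hn
    -- If n times the last vector lay in the span of the others, this would be a linear relation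
    -- with last coefficient -n; independence gives n = 0.
    · have hn' : (n : ℤ) • v (Fin.last k) ∈ Submodule.span ℤ (Set.range (v ∘ Fin.castSucc)) := by
        rw [← Submodule.Quotient.mk_eq_zero, natCast_zsmul]
        exact hn
      obtain ⟨c, hc⟩ := (Submodule.mem_span_range_iff_exists_fun ℤ).1 hn'
      have := Fintype.linearIndependent_iff.1 hv (Fin.snoc c (-(n : ℤ))) (by
        rw [Fin.sum_univ_castSucc]
        simp only [Fin.snoc_castSucc, Fin.snoc_last]
        simp only [Function.comp_apply] at hc
        rw [hc, neg_smul, add_neg_cancel]) (Fin.last k)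
      rw [Fin.snoc_last] at this
      omega

end Twisted

end

end DPV

namespace DPV

noncomputable section

/-! ### Lattices of rational subspaces. -/

section Lattices

variable {Γ : Type u} [AddCommGroup Γ]

/-- The sublattice of `Γ` of the elements lying in the subspace `s`. -/
def lat (s : Submodule ℝ (ℝ ⊗[ℤ] Γ)) : Submodule ℤ Γ := (s.restrictScalars ℤ).comap toV

theorem mem_lat {s : Submodule ℝ (ℝ ⊗[ℤ] Γ)} {γ : Γ} : γ ∈ lat s ↔ toV γ ∈ s := Iff.rfl

theorem lat_saturated {s : Submodule ℝ (ℝ ⊗[ℤ] Γ)} {γ : Γ} {n : ℤ} (hn : n ≠ 0)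
    (h : n • γ ∈ lat s) : γ ∈ lat s := by
  rw [mem_lat, map_smul, ← Int.cast_smul_eq_zsmul ℝ] at h
  exact (s.smul_mem_iff (Int.cast_ne_zero.2 hn)).1 h

/-- Two lattice points lie in a common translate of s exactly when they are congruent modulo `lat
s`, so translates by real vectors may be replaced by cosets in Γ. -/
theorem mem_finTranslates_iff {s : Submodule ℝ (ℝ ⊗[ℤ] Γ)} {f : FunSpace Γ} :
    f ∈ finTranslates s ↔ ((lat s).mkQ '' {x | f x ≠ 0}).Finite := by
  classical
  constructor
  · rintro ⟨T, hT⟩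
    have hs : (lat s).mkQ '' {x | f x ≠ 0} ⊆ ⋃ t ∈ T, (lat s).mkQ '' {x | toV x - t ∈ s} := by
      rintro _ ⟨x, hx, rfl⟩
      obtain ⟨t, ht, h⟩ := hT x hx
      exact Set.mem_biUnion ht ⟨x, h, rfl⟩
    refine (T.finite_toSet.biUnion fun t _ => Set.Subsingleton.finite ?_).subset hs
    rintro _ ⟨x, hx, rfl⟩ _ ⟨y, hy, rfl⟩
    rw [Submodule.mkQ_apply, Submodule.mkQ_apply, Submodule.Quotient.eq, mem_lat, map_sub]
    have := s.sub_mem hx hy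
    rwa [sub_sub_sub_cancel_right] at this
  · intro h
    obtain ⟨σ, hσ⟩ := (Submodule.mkQ_surjective (lat s)).hasRightInverse
    refine ⟨h.toFinset.image fun l => toV (σ l), fun x hx => ⟨toV (σ ((lat s).mkQ x)),
      Finset.mem_image_of_mem _ (h.mem_toFinset.2 ⟨x, hx, rfl⟩), ?_⟩⟩
    rw [← map_sub, ← mem_lat, ← Submodule.Quotient.eq]
    exact (hσ _).symm

theorem finrank_span_toV (L : Submodule ℤ Γ) [Module.Free ℤ L] :
    Module.finrank ℝ (Submodule.span ℝ (toV '' (L : Set Γ))) = Module.finrank ℤ L := by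
  have h : Submodule.baseChange ℝ L = Submodule.span ℝ (toV '' (L : Set Γ)) :=
    Submodule.baseChange_eq_span ℝ L
  rw [← h, ← (Submodule.toBaseChange.toLinearEquiv ℝ L).finrank_eq, Module.finrank_baseChange]

/-- By saturation Γ/`lat s` is torsion-free and finitely generated, hence free, so the quotient map
splits. -/
theorem exists_retraction [Module.Finite ℤ Γ] (s : Submodule ℝ (ℝ ⊗[ℤ] Γ)) :
    ∃ ρ : Γ →ₗ[ℤ] lat s, ∀ γ : lat s, ρ γ = γ := by
  have : Module.IsTorsionFree ℤ (Γ ⧸ lat s) := by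
    refine ⟨fun n hn x y hxy => ?_⟩
    obtain ⟨x, rfl⟩ := Submodule.mkQ_surjective _ x
    obtain ⟨y, rfl⟩ := Submodule.mkQ_surjective _ y
    change n • (lat s).mkQ x = n • (lat s).mkQ y at hxy
    rw [← map_smul, ← map_smul, Submodule.mkQ_apply, Submodule.mkQ_apply, Submodule.Quotient.eq,
      ← smul_sub] at hxy
    exact (Submodule.Quotient.eq _).2 (lat_saturated hn.ne_zero hxy)
  have : Module.Free ℤ (Γ ⧸ lat s) := Module.free_of_finite_type_torsion_free'
  obtain ⟨σ, hσ⟩ := LinearMap.exists_rightInverse_of_surjective (lat s).mkQ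
    (LinearMap.range_eq_top.2 (Submodule.mkQ_surjective _))
  refine ⟨LinearMap.codRestrict (lat s) (LinearMap.id - σ ∘ₗ (lat s).mkQ) fun γ => ?_,
    fun γ => Subtype.ext ?_⟩
  · rw [← Submodule.Quotient.mk_eq_zero]
    have : (lat s).mkQ (σ ((lat s).mkQ γ)) = (lat s).mkQ γ := LinearMap.congr_fun hσ _
    change (lat s).mkQ (γ - σ ((lat s).mkQ γ)) = 0
    rw [map_sub, this, sub_self]
  · change (γ : Γ) - σ ((lat s).mkQ γ) = γ
    rw [Submodule.mkQ_apply, (Submodule.Quotient.mk_eq_zero _).2 γ.2, map_zero, sub_zero]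

variable [Module.Free ℤ Γ]

theorem finrank_V : Module.finrank ℝ (ℝ ⊗[ℤ] Γ) = Module.finrank ℤ Γ := Module.finrank_baseChange

variable [Module.Finite ℤ Γ] {n : ℕ} {X : Fin n → Γ} {s : Submodule ℝ (ℝ ⊗[ℤ] Γ)}

theorem IsRational.finrank_lat (hs : IsRational X s) :
    Module.finrank ℤ (lat s) = Module.finrank ℝ s := by
  suffices h : Submodule.span ℝ (toV '' (lat s : Set Γ)) = s by rw [← finrank_span_toV, h]
  apply le_antisymm
  · rw [Submodule.span_le]
    rintro _ ⟨γ, hγ, rfl⟩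
    exact hγ
  · obtain ⟨A, rfl⟩ := hs
    refine Submodule.span_mono ?_
    rintro _ ⟨k, hk, rfl⟩
    exact ⟨X k, Submodule.subset_span ⟨k, hk, rfl⟩, rfl⟩

omit [Module.Free ℤ Γ] [Module.Finite ℤ Γ] in
theorem finite_isRational (X : Fin n → Γ) : {s | IsRational X s}.Finite := by
  refine (Set.finite_range fun A : Set (Fin n) =>
    Submodule.span ℝ ((fun k => toV (X k)) '' A)).subset ?_
  rintro s ⟨A, rfl⟩
  exact ⟨A, rfl⟩

omit [Module.Free ℤ Γ] [Module.Finite ℤ Γ] in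
theorem isRational_span (X : Fin n → Γ) (A : Set (Fin n)) :
    IsRational X (Submodule.span ℝ ((fun k => toV (X k)) '' A)) := ⟨A, rfl⟩

omit [Module.Free ℤ Γ] [Module.Finite ℤ Γ] in
-- The vectors of X outside s have finitely many nonzero images in V/s, and some functional on V/s
-- vanishes at none of them. It supplies the direction in which every ∇_a with a outside s is
-- inverted.
theorem exists_functional (X : Fin n → Γ) (s : Submodule ℝ (ℝ ⊗[ℤ] Γ)) :
    ∃ u : ℝ ⊗[ℤ] Γ →ₗ[ℝ] ℝ, (∀ v ∈ s, u v = 0) ∧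
      ∀ k, toV (X k) ∉ s → u (toV (X k)) ≠ 0 := by
  obtain ⟨f, hf⟩ := Module.exists_dual_forall_apply_ne_zero (K := ℝ)
    (fun k : {k // toV (X k) ∉ s} => s.mkQ (toV (X k))) fun k hk => k.2 (by simpa using hk)
  refine ⟨f ∘ₗ s.mkQ, fun v hv => ?_, fun k hk => hf ⟨k, hk⟩⟩
  rw [LinearMap.comp_apply, Submodule.mkQ_apply, (Submodule.Quotient.mk_eq_zero _).2 hv, map_zero]

theorem span_range_toV (hrank : Module.finrank ℤ (Submodule.span ℤ (Set.range X)) =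
    Module.finrank ℤ Γ) : Submodule.span ℝ (Set.range fun k => toV (X k)) = ⊤ := by
  have h := finrank_span_toV (Submodule.span ℤ (Set.range X))
  have h2 := (Submodule.baseChange_eq_span ℝ (Submodule.span ℤ (Set.range X))).symm.trans
    (Submodule.baseChange_span ℝ (Set.range X))
  change Submodule.span ℝ (toV '' _) = Submodule.span ℝ (toV '' _) at h2
  rw [← Set.range_comp] at h2
  change _ = Submodule.span ℝ (Set.range fun k => toV (X k)) at h2
  apply Submodule.eq_top_of_finrank_eq
  rw [← h2, finrank_V, ← hrank, ← h]

/-- Adjoining vectors of X one at a time raises the dimension by one until V is reached. This makes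
the product in every degree up to the rank nonempty. -/
theorem exists_isRational_finrank (hrank : Module.finrank ℤ (Submodule.span ℤ (Set.range X)) =
    Module.finrank ℤ Γ) (k : ℕ) (hk : k ≤ Module.finrank ℤ Γ) :
    ∃ s, IsRational X s ∧ Module.finrank ℝ s = k := by
  induction k with
  | zero => exact ⟨⊥, ⟨∅, by simp⟩, finrank_bot ℝ _⟩
  | succ k ih =>
    obtain ⟨s, ⟨A, rfl⟩, hs⟩ := ih (by omega)
    obtain ⟨m, hm⟩ : ∃ m, toV (X m) ∉ Submodule.span ℝ ((fun k => toV (X k)) '' A) := by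
      by_contra! hc
      have : Submodule.span ℝ ((fun k => toV (X k)) '' A) = ⊤ := by
        rw [eq_top_iff, ← span_range_toV hrank, Submodule.span_le]
        rintro _ ⟨m, rfl⟩
        exact hc m
      rw [this, finrank_top, finrank_V] at hs
      omega
    refine ⟨_, isRational_span X (insert m A), ?_⟩
    rw [Set.image_insert_eq, Submodule.span_insert]
    apply le_antisymm
    · have h1 := Submodule.finrank_add_le_finrank_add_finrank (Submodule.span ℝ {toV (X m)})
        (Submodule.span ℝ ((fun k => toV (X k)) '' A))
      have h2 := finrank_span_le_card (R := ℝ) ({toV (X m)} : Set (ℝ ⊗[ℤ] Γ))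
      rw [Set.toFinset_singleton, Finset.card_singleton] at h2
      omega
    · rw [← hs, Nat.succ_le_iff]
      apply Submodule.finrank_lt_finrank_of_lt
      refine lt_of_le_of_ne le_sup_right fun h => hm ?_
      rw [h]
      exact Submodule.mem_sup_left (Submodule.mem_span_singleton_self _)

end Lattices

end

end DPV

namespace DPV

noncomputable section

/-! ### Difference equations for functions bounded below. -/

section Functions

variable {Γ : Type u}

namespace FunSpace

theorem ext {f g : FunSpace Γ} (h : ∀ x, f x = g x) : f = g := funext h

theorem add_apply (f g : FunSpace Γ) (x : Γ) : (f + g) x = f x + g x := rfl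

theorem neg_apply (f : FunSpace Γ) (x : Γ) : (-f) x = -f x := rfl

theorem zero_apply (x : Γ) : (0 : FunSpace Γ) x = 0 := rfl

end FunSpace

variable [AddCommGroup Γ]

/-- Translation invariant subgroups of `C[Γ]` are submodules. -/
def submoduleOfChr (S : AddSubgroup (FunSpace Γ))
    (h : ∀ (γ : Γ) (f : FunSpace Γ), f ∈ S → chr γ • f ∈ S) :
    Submodule (CharRing Γ) (FunSpace Γ) where
  __ := S
  smul_mem' r f hf := by
    change r • f ∈ S
    induction r using AddMonoidAlgebra.induction_linear with
    | zero => rw [zero_smul]; exact S.zero_mem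
    | add p q hp hq => rw [add_smul]; exact S.add_mem hp hq
    | single γ c =>
      rw [single_eq_smul_chr, smul_assoc]
      exact S.zsmul_mem (h γ f hf) c

/-- The functions all of whose values are divisible by `N`. -/
def divBy (Γ : Type u) [AddCommGroup Γ] (N : ℤ) : Submodule (CharRing Γ) (FunSpace Γ) :=
  submoduleOfChr
    { carrier := {f | ∀ x, N ∣ f x}
      add_mem' := fun hf hg x => dvd_add (hf x) (hg x)
      zero_mem' := fun _ => dvd_zero N
      neg_mem' := fun hf x => (dvd_neg).2 (hf x) }
    fun γ f hf x => by
      rw [chr_smul_apply]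
      exact hf _

theorem mem_divBy {N : ℤ} {f : FunSpace Γ} : f ∈ divBy Γ N ↔ ∀ x, N ∣ f x := Iff.rfl

/-- With N = 0, congruences become equalities, so the statements about `divBy` cover integral and
mod p arguments at once. -/
theorem mem_divBy_zero {f : FunSpace Γ} : f ∈ divBy Γ 0 ↔ f = 0 := by
  simp only [mem_divBy, zero_dvd_iff]
  exact ⟨fun h => FunSpace.ext h, fun h x => by rw [h]; rfl⟩

theorem intCast_smul_mem_divBy (N : ℤ) (f : FunSpace Γ) :
    ((N : CharRing Γ) • f : FunSpace Γ) ∈ divBy Γ N := by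
  rw [Int.cast_smul_eq_zsmul]
  exact fun x => ⟨f x, rfl⟩

/-- The functions on whose support the linear functional `u` is bounded below. -/
def bddBelow (u : ℝ ⊗[ℤ] Γ →ₗ[ℝ] ℝ) : Submodule (CharRing Γ) (FunSpace Γ) :=
  submoduleOfChr
    { carrier := {f | ∃ c, ∀ x, f x ≠ 0 → c ≤ u (toV x)}
      add_mem' := by
        rintro f g ⟨c, hc⟩ ⟨c', hc'⟩
        refine ⟨min c c', fun x hx => ?_⟩
        by_cases h : f x = 0
        · refine (min_le_right _ _).trans (hc' x fun h' => hx ?_)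
          rw [FunSpace.add_apply, h, h', add_zero]
        · exact (min_le_left _ _).trans (hc x h)
      zero_mem' := ⟨0, fun x hx => absurd rfl hx⟩
      neg_mem' := by
        rintro f ⟨c, hc⟩
        refine ⟨c, fun x hx => hc x fun h => hx ?_⟩
        rw [FunSpace.neg_apply, h, neg_zero] }
    fun γ f ⟨c, hc⟩ => by
      refine ⟨c + u (toV γ), fun x hx => ?_⟩
      rw [chr_smul_apply] at hx
      have := hc _ hx
      rw [map_sub, map_sub] at this
      linarith

theorem finTranslates_le_bddBelow {s : Submodule ℝ (ℝ ⊗[ℤ] Γ)} {u : ℝ ⊗[ℤ] Γ →ₗ[ℝ] ℝ}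
    (hu : ∀ v ∈ s, u v = 0) : finTranslates s ≤ bddBelow u := by
  classical
  rintro f ⟨T, hT⟩
  obtain ⟨c, hc⟩ := (T.image u).finite_toSet.bddBelow
  refine ⟨c, fun x hx => ?_⟩
  obtain ⟨t, ht, h⟩ := hT x hx
  have h1 := hu _ h
  rw [map_sub, sub_eq_zero] at h1
  rw [h1]
  exact hc (Finset.mem_coe.2 (Finset.mem_image_of_mem u ht))

theorem chr_mul_nabla_neg (a : Γ) : chr a * nabla (-a) = -nabla a := by
  rw [nabla_eq, nabla_eq, mul_sub, ← chr_add, add_neg_cancel, chr_zero, mul_one, neg_sub]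

theorem nabla_eq_mul_nabla_neg (a : Γ) : nabla a = -(chr a * nabla (-a)) := by
  rw [chr_mul_nabla_neg, neg_neg]

section Inverse

variable {u : ℝ ⊗[ℤ] Γ →ₗ[ℝ] ℝ} {a : Γ}

theorem map_toV_sub_nsmul (x : Γ) (m : ℕ) :
    u (toV (x - m • a)) = u (toV x) - m * u (toV a) := by
  rw [map_sub, map_nsmul, map_sub, map_nsmul, nsmul_eq_mul]

/-- The solution is the geometric series of the translates of f by multiples of a. It is finite at
each point because f vanishes far enough in the direction -a, and it stays on the translates of any
subspace containing a. -/
theorem exists_nabla_smul_eq_of_pos (hu : 0 < u (toV a)) {f : FunSpace Γ}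
    (hf : f ∈ bddBelow u) :
    ∃ h ∈ bddBelow u, nabla a • h = f ∧
      ∀ t, toV a ∈ t → f ∈ finTranslates t → h ∈ finTranslates t := by
  obtain ⟨c, hc⟩ := hf
  have hz (x : Γ) : ∃ M : ℕ, ∀ m, M ≤ m → f (x - m • a) = 0 := by
    obtain ⟨M, hM⟩ := exists_nat_gt ((u (toV x) - c) / u (toV a))
    refine ⟨M, fun m hm => ?_⟩
    by_contra hne
    have h1 := hc _ hne
    rw [map_toV_sub_nsmul] at h1
    rw [div_lt_iff₀ hu] at hM
    have : (M : ℝ) * u (toV a) ≤ m * u (toV a) :=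
      mul_le_mul_of_nonneg_right (by exact_mod_cast hm) hu.le
    linarith
  choose M hM using hz
  let h : FunSpace Γ := fun x => ∑ m ∈ Finset.range (M x), f (x - m • a)
  have hh (x : Γ) (K : ℕ) (hK : M x ≤ K) : h x = ∑ m ∈ Finset.range K, f (x - m • a) := by
    refine Finset.sum_subset (Finset.range_subset_range.2 hK) fun m _ hm => hM x m ?_
    simpa using hm
  have hne (x : Γ) (hx : h x ≠ 0) : ∃ m : ℕ, f (x - m • a) ≠ 0 := by
    obtain ⟨m, _, hm⟩ := Finset.exists_ne_zero_of_sum_ne_zero hx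
    exact ⟨m, hm⟩
  refine ⟨h, ⟨c, fun x hx => ?_⟩, FunSpace.ext fun x => ?_, fun t ht ⟨T, hT⟩ => ⟨T, fun x hx => ?_⟩⟩
  · obtain ⟨m, hm⟩ := hne x hx
    have := hc _ hm
    rw [map_toV_sub_nsmul] at this
    have : 0 ≤ (m : ℝ) * u (toV a) := by positivity
    linarith
  -- The series telescopes: at x it is summed to one term more than at x - a, and the surplus is the
  -- term m = 0.
  · rw [nabla_smul_apply, hh x (max (M x) (M (x - a)) + 1) (by omega),
      hh (x - a) (max (M x) (M (x - a))) (by omega), Finset.sum_range_succ', zero_smul, sub_zero]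
    have : ∀ m : ℕ, x - (m + 1) • a = x - a - m • a := fun m => by rw [succ_nsmul]; abel
    simp only [this]
    abel
  · obtain ⟨m, hm⟩ := hne x hx
    obtain ⟨v, hv, h⟩ := hT _ hm
    refine ⟨v, hv, ?_⟩
    have := t.add_mem h (t.smul_mem (m : ℝ) ht)
    rw [map_sub, map_nsmul, Nat.cast_smul_eq_nsmul] at this
    convert this using 1
    abel

/-- A negative direction is reversed by ∇_a = -τ_a ∇_{-a}, whose factor τ_a is invertible. -/
theorem exists_nabla_smul_eq (hu : u (toV a) ≠ 0) {f : FunSpace Γ} (hf : f ∈ bddBelow u) :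
    ∃ h ∈ bddBelow u, nabla a • h = f ∧
      ∀ t, toV a ∈ t → f ∈ finTranslates t → h ∈ finTranslates t := by
  rcases lt_or_gt_of_ne hu with hu | hu
  · obtain ⟨h, h1, h2, h3⟩ := exists_nabla_smul_eq_of_pos (a := -a)
      (by rw [map_neg, map_neg]; linarith) hf
    refine ⟨-(chr (-a) • h), neg_mem (Submodule.smul_mem _ _ h1), ?_, fun t ht hft =>
      neg_mem (Submodule.smul_mem _ _ (h3 t (by rw [map_neg]; exact t.neg_mem ht) hft))⟩
    rw [nabla_eq_mul_nabla_neg, neg_smul, smul_neg, neg_neg, mul_smul, smul_comm (nabla (-a)), h2,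
      chr_smul_neg_smul]
  · exact exists_nabla_smul_eq_of_pos hu hf

/-- Modulo N the function is invariant under translation by a, and it vanishes far out in the
direction -a. This is uniqueness, modulo N, of the series solution. -/
theorem mem_divBy_of_nabla_smul_of_pos {N : ℤ} (hu : 0 < u (toV a)) {h : FunSpace Γ}
    (hh : h ∈ bddBelow u) (hN : nabla a • h ∈ divBy Γ N) : h ∈ divBy Γ N := by
  obtain ⟨c, hc⟩ := hh
  intro x
  have key (m : ℕ) : N ∣ h x - h (x - m • a) := by
    induction m with
    | zero => simp
    | succ m ih =>
      have := hN (x - m • a)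
      rw [nabla_smul_apply, sub_sub, ← succ_nsmul] at this
      simpa using dvd_add ih this
  obtain ⟨m, hm⟩ := exists_nat_gt ((u (toV x) - c) / u (toV a))
  have h0 : h (x - m • a) = 0 := by
    by_contra hne
    have h1 := hc _ hne
    rw [map_toV_sub_nsmul] at h1
    rw [div_lt_iff₀ hu] at hm
    linarith
  have := key m
  rwa [h0, sub_zero] at this

theorem mem_divBy_of_nabla_smul {N : ℤ} (hu : u (toV a) ≠ 0) {h : FunSpace Γ}
    (hh : h ∈ bddBelow u) (hN : nabla a • h ∈ divBy Γ N) : h ∈ divBy Γ N := by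
  rcases lt_or_gt_of_ne hu with hu | hu
  · refine mem_divBy_of_nabla_smul_of_pos (a := -a) (by rw [map_neg, map_neg]; linarith) hh ?_
    rw [nabla_eq_mul_nabla_neg, neg_smul, Submodule.neg_mem_iff, mul_smul] at hN
    rw [← chr_neg_smul_smul a (nabla (-a) • h)]
    exact Submodule.smul_mem _ _ hN
  · exact mem_divBy_of_nabla_smul_of_pos hu hh hN

end Inverse

section Products

variable {u : ℝ ⊗[ℤ] Γ →ₗ[ℝ] ℝ} {ι : Type*} (K : Finset ι) (a : ι → Γ)

theorem exists_prod_nabla_smul_eq (hu : ∀ k ∈ K, u (toV (a k)) ≠ 0) {f : FunSpace Γ}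
    (hf : f ∈ bddBelow u) :
    ∃ h ∈ bddBelow u, (∏ k ∈ K, nabla (a k)) • h = f ∧
      ∀ t, (∀ k ∈ K, toV (a k) ∈ t) → f ∈ finTranslates t → h ∈ finTranslates t := by
  classical
  induction K using Finset.induction_on with
  | empty => exact ⟨f, hf, by simp, fun _ _ h => h⟩
  | insert k K hk ih =>
    obtain ⟨h, h1, h2, h3⟩ := ih fun j hj => hu j (Finset.mem_insert_of_mem hj)
    obtain ⟨h', h1', h2', h3'⟩ := exists_nabla_smul_eq (hu k (Finset.mem_insert_self _ _)) h1
    refine ⟨h', h1', ?_, fun t ht hft => h3' t (ht k (Finset.mem_insert_self _ _))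
      (h3 t (fun j hj => ht j (Finset.mem_insert_of_mem hj)) hft)⟩
    rw [Finset.prod_insert hk, mul_comm, mul_smul, h2', h2]

theorem mem_divBy_of_prod_nabla_smul {N : ℤ} (hu : ∀ k ∈ K, u (toV (a k)) ≠ 0) {h : FunSpace Γ}
    (hh : h ∈ bddBelow u) (hN : (∏ k ∈ K, nabla (a k)) • h ∈ divBy Γ N) : h ∈ divBy Γ N := by
  classical
  induction K using Finset.induction_on with
  | empty => simpa using hN
  | insert k K hk ih =>
    rw [Finset.prod_insert hk, mul_smul] at hN
    exact ih (fun j hj => hu j (Finset.mem_insert_of_mem hj))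
      (mem_divBy_of_nabla_smul (hu k (Finset.mem_insert_self _ _))
        (Submodule.smul_mem _ _ hh) hN)

end Products

end Functions

/-! ### Cocircuit ideals and relations between the products ∇. -/

section Ideals

variable {Γ : Type u} [AddCommGroup Γ] {n : ℕ} (X : Fin n → Γ)

open Classical in
/-- The product of the `∇_a` over the members `a` of `X` lying in `s` but not in `t`. -/
def nablaRel (s t : Submodule ℝ (ℝ ⊗[ℤ] Γ)) : CharRing Γ :=
  ∏ k with toV (X k) ∈ s ∧ toV (X k) ∉ t, nabla (X k)

theorem nablaCompl_mul_nablaRel {s t : Submodule ℝ (ℝ ⊗[ℤ] Γ)} (h : t ≤ s) :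
    nablaCompl X s * nablaRel X s t = nablaCompl X t := by
  classical
  rw [nablaCompl, nablaRel, nablaCompl, ← Finset.prod_union]
  · congr 1
    ext k
    simp only [Finset.mem_union, Finset.mem_filter, Finset.mem_univ, true_and]
    have := @h (toV (X k))
    tauto
  · rw [Finset.disjoint_filter]
    tauto

theorem nablaRel_mul_nablaRel {r s t : Submodule ℝ (ℝ ⊗[ℤ] Γ)} (hrs : r ≤ s) (hst : s ≤ t) :
    nablaRel X t s * nablaRel X s r = nablaRel X t r := by
  classical
  rw [nablaRel, nablaRel, nablaRel, ← Finset.prod_union]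
  · congr 1
    ext k
    simp only [Finset.mem_union, Finset.mem_filter, Finset.mem_univ, true_and]
    have := @hrs (toV (X k))
    have := @hst (toV (X k))
    tauto
  · rw [Finset.disjoint_filter]
    tauto

theorem nablaRel_top (t : Submodule ℝ (ℝ ⊗[ℤ] Γ)) : nablaRel X ⊤ t = nablaCompl X t := by
  classical
  rw [nablaRel, nablaCompl]
  refine Finset.prod_congr (Finset.ext fun k => ?_) fun _ _ => rfl
  simp

theorem nablaCompl_top : nablaCompl X ⊤ = 1 := by
  simp [nablaCompl]

/-- The ideal generated by the `∇_{(X ∩ s) \ t}` for `t ≤ s` rational of dimension less than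
`m`. -/
def relJ (s : Submodule ℝ (ℝ ⊗[ℤ] Γ)) (m : ℕ) : Ideal (CharRing Γ) :=
  Ideal.span {r | ∃ t, IsRational X t ∧ t ≤ s ∧ Module.finrank ℝ t < m ∧ r = nablaRel X s t}

/-- The ideal generated by the `∇_{(X ∩ s) \ t}` for the rational subspaces `t < s`. -/
abbrev cocircuitIdeal (s : Submodule ℝ (ℝ ⊗[ℤ] Γ)) : Ideal (CharRing Γ) :=
  relJ X s (Module.finrank ℝ s)

variable {X}

theorem relJ_zero (s : Submodule ℝ (ℝ ⊗[ℤ] Γ)) : relJ X s 0 = ⊥ := by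
  rw [relJ, Ideal.span_eq_bot]
  rintro r ⟨t, -, -, h, -⟩
  omega

theorem nablaRel_mem_relJ {s t : Submodule ℝ (ℝ ⊗[ℤ] Γ)} {m : ℕ} (ht : IsRational X t)
    (hts : t ≤ s) (hm : Module.finrank ℝ t < m) : nablaRel X s t ∈ relJ X s m :=
  Ideal.subset_span ⟨t, ht, hts, hm, rfl⟩

theorem nablaCompl_mem_idealJ {t : Submodule ℝ (ℝ ⊗[ℤ] Γ)} {m : ℕ} (ht : IsRational X t)
    (hm : Module.finrank ℝ t < m) : nablaCompl X t ∈ idealJ X m :=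
  Ideal.subset_span ⟨t, ht, hm, rfl⟩

theorem relJ_top (m : ℕ) : relJ X ⊤ m = idealJ X m := by
  simp only [relJ, idealJ, le_top, true_and, nablaRel_top]

theorem relJ_mono (s : Submodule ℝ (ℝ ⊗[ℤ] Γ)) {m m' : ℕ} (h : m ≤ m') :
    relJ X s m ≤ relJ X s m' :=
  Ideal.span_mono fun _ ⟨t, h1, h2, h3, h4⟩ => ⟨t, h1, h2, h3.trans_le h, h4⟩

theorem idealJ_mono {m m' : ℕ} (h : m ≤ m') : idealJ X m ≤ idealJ X m' := by
  rw [← relJ_top, ← relJ_top]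
  exact relJ_mono _ h

theorem nablaCompl_mul_mem_idealJ {s : Submodule ℝ (ℝ ⊗[ℤ] Γ)} {m : ℕ} {c : CharRing Γ}
    (hc : c ∈ relJ X s m) : nablaCompl X s * c ∈ idealJ X m := by
  induction hc using Submodule.span_induction with
  | mem r hr =>
    obtain ⟨t, h1, h2, h3, rfl⟩ := hr
    rw [nablaCompl_mul_nablaRel X h2]
    exact nablaCompl_mem_idealJ h1 h3
  | zero => simp
  | add x y _ _ hx hy => rw [mul_add]; exact add_mem hx hy
  | smul r x _ hx => rw [smul_eq_mul, mul_left_comm]; exact Ideal.mul_mem_left _ _ hx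

theorem nablaRel_mul_mem_relJ {s t : Submodule ℝ (ℝ ⊗[ℤ] Γ)} {m : ℕ} {c : CharRing Γ}
    (hst : s ≤ t) (hc : c ∈ relJ X s m) : nablaRel X t s * c ∈ relJ X t m := by
  induction hc using Submodule.span_induction with
  | mem r hr =>
    obtain ⟨v, h1, h2, h3, rfl⟩ := hr
    rw [nablaRel_mul_nablaRel X h2 hst]
    exact nablaRel_mem_relJ h1 (h2.trans hst) h3
  | zero => simp
  | add x y _ _ hx hy => rw [mul_add]; exact add_mem hx hy
  | smul r x _ hx => rw [smul_eq_mul, mul_left_comm]; exact Ideal.mul_mem_left _ _ hx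

variable [Module.Finite ℤ Γ]

/-- If `t` does not contain `s` then `∇_{X \ t}` is a multiple of an element of the cocircuit
ideal of `s`. -/
theorem nablaCompl_mem_cocircuitIdeal {s t : Submodule ℝ (ℝ ⊗[ℤ] Γ)}
    (hst : ¬ s ≤ t) : nablaCompl X t ∈ cocircuitIdeal X s := by
  classical
  -- The intersection of s and t need not be rational; the span of the vectors of X lying in both
  -- is, and it is a proper subspace of s. The factors of ∇_{(X ∩ s) \ t'} all occur in ∇_{X \ t}.
  set t' := Submodule.span ℝ ((fun k => toV (X k)) '' {k | toV (X k) ∈ s ∧ toV (X k) ∈ t}) with ht'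
  have h1 : t' ≤ s := by
    rw [ht', Submodule.span_le]
    rintro _ ⟨k, hk, rfl⟩
    exact hk.1
  have h2 : t' ≤ t := by
    rw [ht', Submodule.span_le]
    rintro _ ⟨k, hk, rfl⟩
    exact hk.2
  have h3 : t' ≠ s := by
    intro h
    exact hst (h ▸ h2)
  have h4 : nablaRel X s t' ∣ nablaCompl X t := by
    refine Finset.prod_dvd_prod_of_subset _ _ _ fun k hk => ?_
    rw [Finset.mem_filter] at hk ⊢
    exact ⟨hk.1, fun h => hk.2.2 (Submodule.subset_span ⟨k, ⟨hk.2.1, h⟩, rfl⟩)⟩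
  exact Ideal.mem_of_dvd _ h4 (nablaRel_mem_relJ (isRational_span X _) h1
    (Submodule.finrank_lt_finrank_of_lt (lt_of_le_of_ne h1 h3)))

omit [Module.Finite ℤ Γ] in
/-- Every function supported on finitely many translates of `s` has a preimage under `∇_{X \ s}`
which satisfies the same equations. -/
theorem exists_nablaCompl_smul_eq (X : Fin n → Γ) {s : Submodule ℝ (ℝ ⊗[ℤ] Γ)} {g : FunSpace Γ}
    (hg : g ∈ finTranslates s) :
    ∃ f : FunSpace Γ, nablaCompl X s • f = g ∧
      (∀ t, s ≤ t → nablaCompl X t • f ∈ finTranslates t) ∧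
      ∀ N (r : CharRing Γ), r • g ∈ divBy Γ N → r • f ∈ divBy Γ N := by
  classical
  obtain ⟨u, hu, huX⟩ := exists_functional X s
  have hgu := finTranslates_le_bddBelow hu hg
  obtain ⟨f, hf, hfg, -⟩ := exists_prod_nabla_smul_eq (Finset.univ.filter fun k => toV (X k) ∉ s) X
    (fun k hk => huX k (Finset.mem_filter.1 hk).2) hgu
  have hfg' : nablaCompl X s • f = g := hfg
  refine ⟨f, hfg', fun t hst => ?_, fun N r hr => ?_⟩
  · have hgt : g ∈ finTranslates t := by
      obtain ⟨T, hT⟩ := hg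
      refine ⟨T, fun x hx => ?_⟩
      obtain ⟨v, hv, h⟩ := hT x hx
      exact ⟨v, hv, hst h⟩
    have hK : ∀ k ∈ Finset.univ.filter fun k => toV (X k) ∈ t ∧ toV (X k) ∉ s,
        u (toV (X k)) ≠ 0 := fun k hk => huX k (Finset.mem_filter.1 hk).2.2
    obtain ⟨h, h1, h2, h3⟩ := exists_prod_nabla_smul_eq
      (Finset.univ.filter fun k => toV (X k) ∈ t ∧ toV (X k) ∉ s) X hK hgu
    -- Both functions are bounded below along u and solve the same equation, since the factors
    -- inside t and those outside t make up ∇_{X \ s}. Uniqueness with N = 0 identifies them.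
    have key : nablaCompl X t • f - h ∈ divBy Γ 0 := by
      refine mem_divBy_of_prod_nabla_smul _ X hK
        (sub_mem (Submodule.smul_mem _ _ hf) h1) ?_
      have h4 : (∏ k with toV (X k) ∈ t ∧ toV (X k) ∉ s, nabla (X k)) * nablaCompl X t =
          nablaCompl X s := by
        rw [mul_comm]
        exact nablaCompl_mul_nablaRel X hst
      rw [smul_sub, h2, ← mul_smul, h4, hfg', sub_self]
      exact zero_mem _
    rw [mem_divBy_zero, sub_eq_zero] at key
    rw [key]
    exact h3 t (fun k hk => (Finset.mem_filter.1 hk).2.1) hgt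
  -- Applying ∇_{X \ s} to r • f gives r • g, so uniqueness modulo N passes divisibility from r • g
  -- to r • f.
  · refine mem_divBy_of_prod_nabla_smul (Finset.univ.filter fun k => toV (X k) ∉ s) X
      (fun k hk => huX k (Finset.mem_filter.1 hk).2) (Submodule.smul_mem _ _ hf) ?_
    change nablaCompl X s • r • f ∈ _
    rw [smul_comm, hfg']
    exact hr

/-- Coefficients of a relation between the `∇_{X \ t}`, `t` of dimension `k`, annihilate the
functions killed by the cocircuit ideals. -/
theorem smul_mem_divBy_of_sum_eq {k : ℕ} {N : ℤ} {ι : Type*} [Fintype ι]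
    (τ : ι → Submodule ℝ (ℝ ⊗[ℤ] Γ)) (hτ : Function.Injective τ)
    (hdim : ∀ i, Module.finrank ℝ (τ i) = k)
    (c : ι → CharRing Γ) {r j : CharRing Γ} (hj : j ∈ idealJ X k)
    (h : ∑ i, c i * nablaCompl X (τ i) = N * r + j) (i : ι) {g : FunSpace Γ}
    (hg : g ∈ finTranslates (τ i)) (hgJ : ∀ b ∈ cocircuitIdeal X (τ i), b • g ∈ divBy Γ N) :
    c i • g ∈ divBy Γ N := by
  obtain ⟨f, h1, -, h3⟩ := exists_nablaCompl_smul_eq X hg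
  have hcomp (t) (ht : ¬ τ i ≤ t) : nablaCompl X t • f ∈ divBy Γ N :=
    h3 N _ (hgJ _ (nablaCompl_mem_cocircuitIdeal ht))
  have hjf : j • f ∈ divBy Γ N := by
    clear h
    induction hj using Submodule.span_induction with
    | mem r hr =>
      obtain ⟨t, -, ht, rfl⟩ := hr
      refine hcomp t fun hle => ?_
      have := Submodule.finrank_mono hle
      rw [hdim] at this
      omega
    | zero => rw [zero_smul]; exact zero_mem _
    | add x y _ _ hx hy =>
      rw [add_smul]
      exact add_mem hx hy
    | smul r x _ hx => rw [smul_assoc]; exact Submodule.smul_mem _ _ hx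
  have hsum : (∑ i, c i * nablaCompl X (τ i)) • f ∈ divBy Γ N := by
    rw [h, add_smul, mul_smul]
    exact add_mem (intCast_smul_mem_divBy N _) hjf
  classical
  rw [Finset.sum_smul, ← Finset.add_sum_erase _ _ (Finset.mem_univ i)] at hsum
  have hrest : ∑ l ∈ Finset.univ.erase i, (c l * nablaCompl X (τ l)) • f ∈ divBy Γ N := by
    refine Submodule.sum_mem _ fun l hl => ?_
    rw [mul_smul]
    refine Submodule.smul_mem _ _ (hcomp _ fun hle => ?_)
    have := Submodule.eq_of_le_of_finrank_eq hle ((hdim i).trans (hdim l).symm)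
    exact (Finset.mem_erase.1 hl).1 (hτ this.symm)
  have := (Submodule.add_mem_iff_left _ hrest).1 hsum
  rwa [mul_smul, h1] at this

end Ideals

end

end DPV

namespace DPV

noncomputable section

/-! ### Torsion-freeness of the quotients by the ideals. -/

section Saturation

variable {Γ : Type u} [AddCommGroup Γ]

theorem smul_apply_eq_sum (r : CharRing Γ) (f : FunSpace Γ) (x : Γ) :
    (r • f : FunSpace Γ) x = r.coeff.sum fun γ m => m * f (x - γ) := by
  induction r using AddMonoidAlgebra.induction_linear with
  | zero => simp [FunSpace.zero_apply]
  | add p q hp hq =>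
    rw [add_smul, FunSpace.add_apply, hp, hq, AddMonoidAlgebra.coeff_add,
      Finsupp.sum_add_index' (by simp) (by simp [add_mul])]
  | single γ c =>
    rw [single_smul_apply, AddMonoidAlgebra.coeff_single, Finsupp.sum_single_index (by simp)]

open Classical in
/-- Restriction of a function to a subset, extended by zero. -/
def restrictTo (U : Set Γ) : FunSpace Γ →+ FunSpace Γ :=
  AddMonoidHom.mk' (fun f x => if x ∈ U then f x else 0) fun f g => FunSpace.ext fun x => by
    change (if x ∈ U then f x + g x else 0) = (if x ∈ U then f x else 0) + if x ∈ U then g x else 0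
    by_cases h : x ∈ U <;> simp only [h, if_true, if_false, add_zero]

omit [AddCommGroup Γ] in
theorem restrictTo_of_mem {U : Set Γ} {x : Γ} (h : x ∈ U) (f : FunSpace Γ) :
    restrictTo U f x = f x := if_pos h

omit [AddCommGroup Γ] in
theorem restrictTo_of_notMem {U : Set Γ} {x : Γ} (h : x ∉ U) (f : FunSpace Γ) :
    restrictTo U f x = 0 := if_neg h

theorem restrictTo_mem_divBy (U : Set Γ) {N : ℤ} {f : FunSpace Γ} (hf : f ∈ divBy Γ N) :
    restrictTo U f ∈ divBy Γ N := fun x => by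
  by_cases h : x ∈ U
  · rw [restrictTo_of_mem h]
    exact hf x
  · rw [restrictTo_of_notMem h]
    exact dvd_zero N

theorem nabla_smul_restrictTo {U : Set Γ} {a : Γ} (hU : ∀ x, x - a ∈ U ↔ x ∈ U)
    (f : FunSpace Γ) : nabla a • restrictTo U f = restrictTo U (nabla a • f) := by
  refine FunSpace.ext fun x => ?_
  rw [nabla_smul_apply]
  by_cases h : x ∈ U
  · rw [restrictTo_of_mem h, restrictTo_of_mem ((hU x).2 h), restrictTo_of_mem h,
      nabla_smul_apply]
  · rw [restrictTo_of_notMem h, restrictTo_of_notMem fun h' => h ((hU x).1 h'),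
      restrictTo_of_notMem h, sub_zero]

theorem prod_nabla_smul_restrictTo {ι : Type*} (K : Finset ι) (a : ι → Γ) {U : Set Γ}
    (hU : ∀ k ∈ K, ∀ x, x - a k ∈ U ↔ x ∈ U) (f : FunSpace Γ) :
    (∏ k ∈ K, nabla (a k)) • restrictTo U f = restrictTo U ((∏ k ∈ K, nabla (a k)) • f) := by
  classical
  induction K using Finset.induction_on generalizing f with
  | empty => simp
  | insert k K hk ih =>
    rw [Finset.prod_insert hk, mul_smul, mul_smul,
      ih (fun j hj => hU j (Finset.mem_insert_of_mem hj)),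
      nabla_smul_restrictTo (hU k (Finset.mem_insert_self _ _))]

variable {n : ℕ} {X : Fin n → Γ}

/-- A function killed by the cocircuit ideal of `s` may be replaced by one supported on finitely
many translates of `s` without changing finitely many of its values. -/
theorem exists_mem_finTranslates {s : Submodule ℝ (ℝ ⊗[ℤ] Γ)} {N : ℤ} {f : FunSpace Γ}
    (hf : ∀ b ∈ cocircuitIdeal X s, b • f ∈ divBy Γ N) (c : CharRing Γ) :
    ∃ g ∈ finTranslates s, (∀ b ∈ cocircuitIdeal X s, b • g ∈ divBy Γ N) ∧
      (c • g : FunSpace Γ) 0 = (c • f : FunSpace Γ) 0 := by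
  classical
  -- The value of c • f at 0 involves f only at the negatives of the support of c. U is the union of
  -- the cosets of `lat s` through these points; being invariant under `lat s`, cutting off to U
  -- commutes with the generators of the cocircuit ideal.
  let U : Set Γ := {x | (lat s).mkQ x ∈ (fun γ => (lat s).mkQ (-γ)) '' (c.coeff.support : Set Γ)}
  have hU (a : Γ) (ha : toV a ∈ s) (x : Γ) : x - a ∈ U ↔ x ∈ U := by
    have : (lat s).mkQ (x - a) = (lat s).mkQ x := by
      rw [Submodule.mkQ_apply, Submodule.mkQ_apply, Submodule.Quotient.eq, sub_sub_cancel_left]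
      exact (lat s).neg_mem ha
    simp only [U, Set.mem_ofPred_eq, this]
  refine ⟨restrictTo U f, ?_, fun b hb => ?_, ?_⟩
  · rw [mem_finTranslates_iff]
    refine ((c.coeff.support.finite_toSet).image fun γ => (lat s).mkQ (-γ)).subset ?_
    rintro _ ⟨x, hx, rfl⟩
    by_contra h
    exact hx (restrictTo_of_notMem (U := U) h f)
  · induction hb using Submodule.span_induction with
    | mem r hr =>
      obtain ⟨t, h1, h2, h3, rfl⟩ := hr
      have := prod_nabla_smul_restrictTo
        (Finset.univ.filter fun k => toV (X k) ∈ s ∧ toV (X k) ∉ t) X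
        (fun k hk => hU (X k) (Finset.mem_filter.1 hk).2.1) f
      rw [nablaRel, this]
      exact restrictTo_mem_divBy U (hf _ (nablaRel_mem_relJ h1 h2 h3))
    | zero => rw [zero_smul]; exact zero_mem _
    | add x y _ _ hx hy => rw [add_smul]; exact add_mem hx hy
    | smul r x _ hx => rw [smul_assoc]; exact Submodule.smul_mem _ _ hx
  · rw [smul_apply_eq_sum, smul_apply_eq_sum]
    refine Finset.sum_congr rfl fun γ hγ => ?_
    change c.coeff γ * restrictTo U f (0 - γ) = c.coeff γ * f (0 - γ)
    rw [restrictTo_of_mem]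
    exact ⟨γ, hγ, by rw [zero_sub]⟩

/-- An element annihilating (modulo `N`) the functions killed by the cocircuit ideal of `s` is
killed by the additive functionals vanishing on this ideal. -/
theorem apply_eq_zero_of_annihilates {s : Submodule ℝ (ℝ ⊗[ℤ] Γ)} {N : ℕ} {c : CharRing Γ}
    (hc : ∀ g ∈ finTranslates s, (∀ b ∈ cocircuitIdeal X s, b • g ∈ divBy Γ (N : ℤ)) →
      c • g ∈ divBy Γ (N : ℤ))
    (φ : CharRing Γ →+ ZMod N) (hφ : ∀ b ∈ cocircuitIdeal X s, φ b = 0) : φ c = 0 := by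
  -- The matrix coefficient of φ, lifted to the integers: r • f at x reduces to φ(r · chr(-x)). Thus
  -- f is killed modulo N by the ideal, and c • f at 0 reduces to φ c.
  let f : FunSpace Γ := fun x => (φ (chr (-x))).cast
  have hf (r : CharRing Γ) (x : Γ) : (((r • f : FunSpace Γ) x : ℤ) : ZMod N) =
      φ (r * chr (-x)) := by
    induction r using AddMonoidAlgebra.induction_linear with
    | zero => simp [FunSpace.zero_apply]
    | add p q hp hq => rw [add_smul, FunSpace.add_apply, Int.cast_add, hp, hq, add_mul, map_add]
    | single γ m =>
      have : (AddMonoidAlgebra.single γ m : CharRing Γ) * chr (-x) = m • chr (-(x - γ)) := by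
        rw [single_eq_smul_chr, smul_mul_assoc, ← chr_add, neg_sub, sub_eq_add_neg]
      rw [single_smul_apply, this, map_zsmul, zsmul_eq_mul, Int.cast_mul, ZMod.intCast_cast,
        ZMod.cast_id]
  obtain ⟨g, hg, hgb, hgc⟩ := exists_mem_finTranslates (X := X) (s := s) (N := N) (f := f)
    (fun b hb x => by
      rw [← CharP.intCast_eq_zero_iff (ZMod N) N, hf]
      exact hφ _ (Ideal.mul_mem_right _ _ hb)) c
  have h1 := hc g hg hgb 0
  rw [hgc, ← CharP.intCast_eq_zero_iff (ZMod N) N, hf, neg_zero, chr_zero, mul_one] at h1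
  exact h1

theorem eq_zero_of_forall_dual {K A : Type*} [Field K] [AddCommGroup A] [Module K A] {a : A}
    (h : ∀ φ : A →ₗ[K] K, φ a = 0) : a = 0 :=
  (Module.forall_dual_apply_eq_zero_iff K a).1 h

theorem eq_zero_of_forall_hom_zmod {A : Type*} [AddCommGroup A] {p : ℕ} [Fact p.Prime]
    (hA : ∀ x : A, p • x = 0) {a : A} (h : ∀ φ : A →+ ZMod p, φ a = 0) : a = 0 := by
  let _ : Module (ZMod p) A := AddCommGroup.zmodModule hA
  exact eq_zero_of_forall_dual (K := ZMod p) fun φ => h φ.toAddMonoidHom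

/-- The quotient by the cocircuit ideal and p is a vector space over the field with p elements, so
functionals to `ZMod p` detect membership. -/
theorem mem_cocircuitIdeal_sup_of_annihilates {s : Submodule ℝ (ℝ ⊗[ℤ] Γ)} {p : ℕ}
    (hp : p.Prime) {c : CharRing Γ}
    (hc : ∀ g ∈ finTranslates s, (∀ b ∈ cocircuitIdeal X s, b • g ∈ divBy Γ (p : ℤ)) →
      c • g ∈ divBy Γ (p : ℤ)) :
    c ∈ cocircuitIdeal X s ⊔ Ideal.span {(p : CharRing Γ)} := by
  set I := cocircuitIdeal X s ⊔ Ideal.span {(p : CharRing Γ)} with hI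
  have := Fact.mk hp
  have hpI (x : CharRing Γ ⧸ I) : p • x = 0 := by
    obtain ⟨x, rfl⟩ := Ideal.Quotient.mk_surjective x
    rw [← map_nsmul, Ideal.Quotient.eq_zero_iff_mem, nsmul_eq_mul]
    exact Ideal.mul_mem_right _ _ (Ideal.mem_sup_right (Ideal.mem_span_singleton_self _))
  rw [← Ideal.Quotient.eq_zero_iff_mem]
  refine eq_zero_of_forall_hom_zmod hpI fun φ => ?_
  refine apply_eq_zero_of_annihilates hc
    (φ.comp (Ideal.Quotient.mk I).toAddMonoidHom) fun b hb => ?_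
  change φ (Ideal.Quotient.mk I b) = 0
  rw [Ideal.Quotient.eq_zero_iff_mem.2 (Ideal.mem_sup_left hb), map_zero]

variable (X) in
/-- The rational subspaces of `s` of dimension `m`. -/
abbrev RatDim (s : Submodule ℝ (ℝ ⊗[ℤ] Γ)) (m : ℕ) : Type u :=
  {t : Submodule ℝ (ℝ ⊗[ℤ] Γ) // IsRational X t ∧ t ≤ s ∧ Module.finrank ℝ t = m}

instance (s : Submodule ℝ (ℝ ⊗[ℤ] Γ)) (m : ℕ) : Finite (RatDim X s m) :=
  Set.Finite.subset (finite_isRational X) fun _ ht => ht.1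

instance (s : Submodule ℝ (ℝ ⊗[ℤ] Γ)) (m : ℕ) : Fintype (RatDim X s m) := Fintype.ofFinite _

theorem mem_relJ_succ {s : Submodule ℝ (ℝ ⊗[ℤ] Γ)} {m : ℕ} {x : CharRing Γ} :
    x ∈ relJ X s (m + 1) ↔ ∃ c : RatDim X s m → CharRing Γ, ∃ j ∈ relJ X s m,
      ∑ t, c t * nablaRel X s t + j = x := by
  have h : relJ X s (m + 1) =
      Submodule.span (CharRing Γ) (Set.range fun t : RatDim X s m => nablaRel X s t) ⊔
        relJ X s m := by
    rw [relJ, relJ, Ideal.span, Ideal.span, ← Submodule.span_union]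
    congr 1
    ext r
    simp only [Set.mem_union, Set.mem_range, Set.mem_ofPred_eq]
    constructor
    · rintro ⟨t, h1, h2, h3, rfl⟩
      rcases Nat.lt_succ_iff_lt_or_eq.1 h3 with h | h
      · exact Or.inr ⟨t, h1, h2, h, rfl⟩
      · exact Or.inl ⟨⟨t, h1, h2, h⟩, rfl⟩
    · rintro (⟨t, rfl⟩ | ⟨t, h1, h2, h3, rfl⟩)
      · exact ⟨t, t.2.1, t.2.2.1, by rw [t.2.2.2]; omega, rfl⟩
      · exact ⟨t, h1, h2, by omega, rfl⟩
  rw [h, Submodule.mem_sup]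
  simp only [Submodule.mem_span_range_iff_exists_fun, smul_eq_mul]
  constructor
  · rintro ⟨_, ⟨c, rfl⟩, j, hj, rfl⟩
    exact ⟨c, j, hj, rfl⟩
  · rintro ⟨c, j, hj, rfl⟩
    exact ⟨_, ⟨c, rfl⟩, j, hj, rfl⟩

variable [Module.Finite ℤ Γ]

/-- An expression of p · c through generators of top dimension is a relation modulo p, so its
coefficients lie in the respective cocircuit ideals up to multiples of p. Those multiples are
subtracted from c, and what remains is one dimension lower. -/
theorem mem_relJ_of_prime_mul_mem {s : Submodule ℝ (ℝ ⊗[ℤ] Γ)} {p : ℕ} (hp : p.Prime) (m : ℕ)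
    {c : CharRing Γ} (hc : (p : CharRing Γ) * c ∈ relJ X s m) : c ∈ relJ X s m := by
  induction m generalizing c with
  | zero =>
    rw [relJ_zero, Ideal.mem_bot] at hc ⊢
    rw [← nsmul_eq_mul, ← AddMonoidAlgebra.coeff_inj] at hc
    refine AddMonoidAlgebra.ext (Finsupp.ext fun γ => ?_)
    have := DFunLike.congr_fun hc γ
    rw [AddMonoidAlgebra.coeff_smul, Finsupp.smul_apply, nsmul_eq_mul] at this
    exact (mul_eq_zero.1 this).resolve_left (by exact_mod_cast hp.ne_zero)
  | succ m ih =>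
    obtain ⟨b, j, hj, hbj⟩ := mem_relJ_succ.1 hc
    -- Multiplication by ∇_{X \ s} turns the relation inside s into one among the ∇_{X \ t}, to
    -- which the action on functions applies.
    have hb (t : RatDim X s m) :
        b t ∈ cocircuitIdeal X (t : Submodule ℝ (ℝ ⊗[ℤ] Γ)) ⊔ Ideal.span {(p : CharRing Γ)} := by
      refine mem_cocircuitIdeal_sup_of_annihilates hp fun g hg hgJ => ?_
      refine smul_mem_divBy_of_sum_eq (fun t : RatDim X s m => t.1) Subtype.val_injective
        (fun t => t.2.2.2) b (N := p) (r := nablaCompl X s * c) (j := -(nablaCompl X s * j))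
        (neg_mem (nablaCompl_mul_mem_idealJ hj)) ?_ t hg hgJ
      have h1 : ∑ t : RatDim X s m, b t * nablaCompl X t.1 =
          nablaCompl X s * ∑ t : RatDim X s m, b t * nablaRel X s t := by
        rw [Finset.mul_sum]
        refine Finset.sum_congr rfl fun t _ => ?_
        rw [← nablaCompl_mul_nablaRel X t.2.2.1]
        ring
      rw [h1, eq_sub_of_add_eq hbj]
      push_cast
      ring
    choose b₁ hb₁ b₂ hb₂ hb₁₂ using fun t => Submodule.mem_sup.1 (hb t)
    choose b₃ hb₃ using fun t => Ideal.mem_span_singleton'.1 (hb₂ t)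
    -- Here `b₃` collects the quotients by p of the p-divisible parts of the coefficients; the parts
    -- `b₁` contribute only to the ideal of level m.
    have h1 : (p : CharRing Γ) * (c - ∑ t, b₃ t * nablaRel X s t) ∈ relJ X s m := by
      have : (p : CharRing Γ) * (c - ∑ t, b₃ t * nablaRel X s t) =
          ∑ t, b₁ t * nablaRel X s t + j := by
        rw [mul_sub, ← hbj, Finset.mul_sum, add_sub_right_comm, ← Finset.sum_sub_distrib]
        congr 1
        refine Finset.sum_congr rfl fun t _ => ?_
        rw [← hb₁₂, ← hb₃]
        ring
      rw [this]
      refine add_mem (Ideal.sum_mem _ fun t _ => ?_) hj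
      rw [mul_comm]
      refine nablaRel_mul_mem_relJ t.2.2.1 ?_
      have := hb₁ t
      rwa [cocircuitIdeal, t.2.2.2] at this
    have h2 := ih h1
    have := add_mem (relJ_mono s (Nat.le_succ m) h2)
      (mem_relJ_succ.2 ⟨b₃, 0, zero_mem _, rfl⟩)
    simpa using this

theorem mem_relJ_of_natCast_mul_mem {s : Submodule ℝ (ℝ ⊗[ℤ] Γ)} {m : ℕ} (k : ℕ) (hk : k ≠ 0)
    {c : CharRing Γ} (hc : (k : CharRing Γ) * c ∈ relJ X s m) : c ∈ relJ X s m := by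
  induction k using induction_on_primes generalizing c with
  | zero => exact absurd rfl hk
  | one => simpa using hc
  | prime_mul p a hp ih =>
    rw [Nat.cast_mul, mul_assoc] at hc
    exact ih (fun h => hk (by rw [h, mul_zero])) (mem_relJ_of_prime_mul_mem hp m hc)

instance isTorsionFree_quotient_relJ (s : Submodule ℝ (ℝ ⊗[ℤ] Γ)) (m : ℕ) :
    Module.IsTorsionFree ℤ (CharRing Γ ⧸ relJ X s m) := by
  refine ⟨fun k hk => (isSMulRegular_iff_right_eq_zero_of_smul).2 fun x hx => ?_⟩
  obtain ⟨x, rfl⟩ := Ideal.Quotient.mk_surjective x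
  rw [← map_zsmul, Ideal.Quotient.eq_zero_iff_mem] at hx
  rw [Ideal.Quotient.eq_zero_iff_mem]
  refine mem_relJ_of_natCast_mul_mem k.natAbs (Int.natAbs_ne_zero.2 hk.ne_zero) ?_
  rcases Int.natAbs_eq k with h | h
  · rw [h] at hx
    rwa [natCast_zsmul, nsmul_eq_mul] at hx
  · rw [h] at hx
    rwa [neg_smul, natCast_zsmul, nsmul_eq_mul, neg_mem_iff] at hx

end Saturation

end

end DPV

namespace DPV

noncomputable section

/-! ### The lattice quotient is finite and free over ℤ. -/

section LatQuot

variable {Γ : Type u} [AddCommGroup Γ]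

/-- The inclusion of the character ring of the sublattice of `s`. -/
def latIncl (s : Submodule ℝ (ℝ ⊗[ℤ] Γ)) : CharRing (lat s) →+* CharRing Γ :=
  AddMonoidAlgebra.mapDomainRingHom ℤ (lat s).subtype.toAddMonoidHom

theorem latIncl_chr {s : Submodule ℝ (ℝ ⊗[ℤ] Γ)} (γ : lat s) :
    latIncl s (chr γ) = chr (γ : Γ) := by
  rw [latIncl, AddMonoidAlgebra.mapDomainRingHom_apply, chr, AddMonoidAlgebra.mapDomain_single]
  rfl

theorem latIncl_nabla {s : Submodule ℝ (ℝ ⊗[ℤ] Γ)} (γ : lat s) :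
    latIncl s (nabla γ) = nabla (γ : Γ) := by
  rw [nabla_eq, nabla_eq, map_sub, map_one, latIncl_chr]

variable {n : ℕ} (X : Fin n → Γ) (s : Submodule ℝ (ℝ ⊗[ℤ] Γ))

open Classical in
/-- The members of `X` lying in `s`, as elements of the sublattice of `s`. -/
def latVec (k : Fin n) : lat s := if h : X k ∈ lat s then ⟨X k, h⟩ else 0

variable {X s}

theorem coe_latVec {k : Fin n} (h : toV (X k) ∈ s) : (latVec X s k : Γ) = X k := by
  rw [latVec, dif_pos (mem_lat.2 h)]

variable (X s)

open Classical in
/-- The element `∇_{(X ∩ s) \ t}` of the character ring of the sublattice of `s`. -/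
def latNabla (t : Submodule ℝ (ℝ ⊗[ℤ] Γ)) : CharRing (lat s) :=
  ∏ k with toV (X k) ∈ s ∧ toV (X k) ∉ t, nabla (latVec X s k)

theorem latIncl_latNabla (t : Submodule ℝ (ℝ ⊗[ℤ] Γ)) :
    latIncl s (latNabla X s t) = nablaRel X s t := by
  classical
  rw [latNabla, nablaRel, map_prod]
  refine Finset.prod_congr rfl fun k hk => ?_
  rw [latIncl_nabla, coe_latVec (Finset.mem_filter.1 hk).2.1]

/-- The cocircuit ideal in the character ring of the sublattice of `s`. -/
def latIdeal : Ideal (CharRing (lat s)) := (cocircuitIdeal X s).comap (latIncl s)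

variable {X s}

theorem mem_latIdeal {b : CharRing (lat s)} :
    b ∈ latIdeal X s ↔ latIncl s b ∈ cocircuitIdeal X s := Iff.rfl

theorem latNabla_mem_latIdeal {t : Submodule ℝ (ℝ ⊗[ℤ] Γ)} (ht : IsRational X t) (hts : t ≤ s)
    (h : Module.finrank ℝ t < Module.finrank ℝ s) : latNabla X s t ∈ latIdeal X s := by
  rw [mem_latIdeal, latIncl_latNabla]
  exact nablaRel_mem_relJ ht hts h

variable [Module.Finite ℤ Γ]

/-- A lattice element in the real span of a sublattice has a multiple in the sublattice. -/
theorem exists_nsmul_mem_of_toV_mem_span {L : Submodule ℤ Γ} {γ : Γ}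
    (h : toV γ ∈ Submodule.span ℝ (toV '' (L : Set Γ))) : ∃ N : ℕ, N ≠ 0 ∧ N • γ ∈ L := by
  by_contra! hc
  -- If no nonzero multiple of γ lay in L, then γ would survive in the free part of Γ/L and be
  -- detected by an integral functional. Its real extension vanishes on the span of L but not at γ.
  let T := Submodule.torsion ℤ (Γ ⧸ L)
  have : Module.Free ℤ ((Γ ⧸ L) ⧸ T) := Module.free_of_finite_type_torsion_free'
  have hγ : T.mkQ (L.mkQ γ) ≠ 0 := by
    intro h0
    rw [Submodule.mkQ_apply, Submodule.Quotient.mk_eq_zero, Submodule.mem_torsion_iff] at h0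
    obtain ⟨a, ha⟩ := h0
    have ha' : (a : ℤ) • γ ∈ L := by
      rw [← Submodule.Quotient.mk_eq_zero, Submodule.Quotient.mk_smul]
      exact ha
    refine hc (a : ℤ).natAbs (Int.natAbs_ne_zero.2 (nonZeroDivisors.coe_ne_zero a)) ?_
    rcases Int.natAbs_eq (a : ℤ) with h | h
    · rw [h, natCast_zsmul] at ha'
      exact ha'
    · rw [h, neg_smul, natCast_zsmul, neg_mem_iff] at ha'
      exact ha'
  obtain ⟨φ, hφ⟩ : ∃ φ : Module.Dual ℤ ((Γ ⧸ L) ⧸ T), φ (T.mkQ (L.mkQ γ)) ≠ 0 := by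
    by_contra! h0
    exact hγ ((Module.forall_dual_apply_eq_zero_iff ℤ _).1 h0)
  let ψ : Γ →ₗ[ℤ] ℤ := φ ∘ₗ T.mkQ ∘ₗ L.mkQ
  let Ψ : ℝ ⊗[ℤ] Γ →ₗ[ℝ] ℝ ⊗[ℤ] ℤ := ψ.baseChange ℝ
  have hΨ (x : Γ) : Ψ (toV x) = (1 : ℝ) ⊗ₜ ψ x := LinearMap.baseChange_tmul _ _ _
  have hle : Submodule.span ℝ (toV '' (L : Set Γ)) ≤ LinearMap.ker Ψ := by
    rw [Submodule.span_le]
    rintro _ ⟨x, hx, rfl⟩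
    have hx0 : ψ x = 0 := by
      change φ (T.mkQ (L.mkQ x)) = 0
      rw [Submodule.mkQ_apply L, (Submodule.Quotient.mk_eq_zero L).2 hx, map_zero, map_zero]
    rw [SetLike.mem_coe, LinearMap.mem_ker, hΨ, hx0, TensorProduct.tmul_zero]
  have h1 := hle h
  rw [LinearMap.mem_ker, hΨ] at h1
  have h2 := congrArg (TensorProduct.rid ℤ ℝ) h1
  rw [TensorProduct.rid_tmul, map_zero, zsmul_eq_mul, mul_one, Int.cast_eq_zero] at h2
  exact hφ h2

theorem exists_nsmul_mem_span_latVec (S : Finset (Fin n)) (hS : ∀ k ∈ S, toV (X k) ∈ s)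
    (hspan : s ≤ Submodule.span ℝ ((fun k => toV (X k)) '' S)) (γ : lat s) :
    ∃ N : ℕ, N ≠ 0 ∧ N • γ ∈ AddSubgroup.closure (latVec X s '' S) := by
  obtain ⟨N, hN, h⟩ := exists_nsmul_mem_of_toV_mem_span
    (L := AddSubgroup.toIntSubmodule ((AddSubgroup.closure (latVec X s '' S)).map
      (lat s).subtype.toAddMonoidHom)) (γ := (γ : Γ)) (by
    refine (Submodule.span_mono ?_) (hspan γ.2)
    rintro _ ⟨k, hk, rfl⟩
    exact ⟨X k, ⟨latVec X s k, AddSubgroup.subset_closure ⟨k, hk, rfl⟩, coe_latVec (hS k hk)⟩, rfl⟩)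
  refine ⟨N, hN, ?_⟩
  obtain ⟨x, hx, hxe⟩ := h
  have : x = N • γ := Subtype.ext hxe
  rwa [← this]

/-- The group of characters congruent to `1` modulo an ideal. -/
def congrOne {Λ : Type*} [AddCommGroup Λ] (P : Ideal (CharRing Λ)) : AddSubgroup Λ where
  carrier := {γ | nabla γ ∈ P}
  zero_mem' := by
    rw [Set.mem_ofPred_eq, nabla_eq, chr_zero, sub_self]
    exact P.zero_mem
  add_mem' {a b} ha hb := by
    have : nabla (a + b) = nabla a + chr a * nabla b := by
      rw [nabla_eq, nabla_eq, nabla_eq, chr_add]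
      ring
    rw [Set.mem_ofPred_eq, this]
    exact P.add_mem ha (P.mul_mem_left _ hb)
  neg_mem' {a} ha := by
    have : nabla (-a) = -(chr (-a) * nabla a) := by
      rw [nabla_eq_mul_nabla_neg, neg_neg]
    rw [Set.mem_ofPred_eq, this]
    exact P.neg_mem (P.mul_mem_left _ ha)

theorem chr_nsmul {Λ : Type*} [AddCommGroup Λ] (N : ℕ) (γ : Λ) :
    chr (N • γ) = chr γ ^ N := by
  induction N with
  | zero => rw [zero_smul, pow_zero, chr_zero]
  | succ N ih => rw [succ_nsmul, chr_add, ih, pow_succ]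

open Classical in
/-- Modulo the cocircuit ideal the characters are integral over `ℤ`. -/
theorem isIntegral_chr (γ : lat s) :
    IsIntegral ℤ (Ideal.Quotient.mk (latIdeal X s) (chr γ)) := by
  -- The subfamilies of X spanning s. For each of them some multiple N S of γ is an integral
  -- combination of its vectors, and the product of all x^(N S) - 1 is a monic polynomial that will
  -- be nilpotent at γ.
  let 𝒮 : Finset (Finset (Fin n)) := Finset.univ.filter fun S =>
    (∀ k ∈ S, toV (X k) ∈ s) ∧ s ≤ Submodule.span ℝ ((fun k => toV (X k)) '' (S : Set (Fin n)))
  have hN (S : Finset (Fin n)) : ∃ N : ℕ, N ≠ 0 ∧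
      (S ∈ 𝒮 → N • γ ∈ AddSubgroup.closure (latVec X s '' S)) := by
    by_cases h : S ∈ 𝒮
    · obtain ⟨N, hN, h'⟩ := exists_nsmul_mem_span_latVec (X := X) S (Finset.mem_filter.1 h).2.1
        (Finset.mem_filter.1 h).2.2 γ
      exact ⟨N, hN, fun _ => h'⟩
    · exact ⟨1, one_ne_zero, fun h' => absurd h' h⟩
  choose N hN0 hN using hN
  let p : Polynomial ℤ := ∏ S ∈ 𝒮, (Polynomial.X ^ N S - Polynomial.C 1)
  have hp : p.Monic := Polynomial.monic_prod_of_monic _ _ fun S _ =>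
    Polynomial.monic_X_pow_sub_C 1 (hN0 S)
  have hrad : Polynomial.aeval (chr γ) p ∈ (latIdeal X s).radical := by
    rw [Ideal.radical_eq_sInf, Submodule.mem_sInf]
    rintro P ⟨hJP, hP⟩
    -- The vectors congruent to 1 modulo the prime P. They span s: otherwise their span t would be a
    -- proper rational subspace, ∇_{(X ∩ s) \ t} would lie in P, and hence one of its factors would,
    -- although all its vectors lie outside t.
    let S : Finset (Fin n) :=
      Finset.univ.filter fun k => toV (X k) ∈ s ∧ nabla (latVec X s k) ∈ P
    have hS : S ∈ 𝒮 := by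
      refine Finset.mem_filter.2 ⟨Finset.mem_univ _, fun k hk => (Finset.mem_filter.1 hk).2.1, ?_⟩
      set t := Submodule.span ℝ ((fun k => toV (X k)) '' (S : Set (Fin n))) with ht
      have hts : t ≤ s := by
        rw [ht, Submodule.span_le]
        rintro _ ⟨k, hk, rfl⟩
        exact (Finset.mem_filter.1 hk).2.1
      by_contra hst
      have hlt : t < s := lt_of_le_of_ne hts fun h => hst h.ge
      have h1 := hJP (latNabla_mem_latIdeal (isRational_span X _) hts
        (Submodule.finrank_lt_finrank_of_lt hlt))
      obtain ⟨k, hk, hkP⟩ := (hP.prod_mem_iff).1 h1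
      have hk' := (Finset.mem_filter.1 hk).2
      exact hk'.2 (Submodule.subset_span
        ⟨k, Finset.mem_filter.2 ⟨Finset.mem_univ _, hk'.1, hkP⟩, rfl⟩)
    have hle : AddSubgroup.closure (latVec X s '' S) ≤ congrOne P := by
      rw [AddSubgroup.closure_le]
      rintro _ ⟨k, hk, rfl⟩
      exact (Finset.mem_filter.1 hk).2.2
    have h2 : nabla (N S • γ) ∈ P := hle (hN S hS)
    rw [map_prod]
    refine Ideal.mem_of_dvd _ (Finset.dvd_prod_of_mem _ hS) ?_
    rw [nabla_eq, chr_nsmul, ← neg_mem_iff, neg_sub] at h2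
    simpa using h2
  obtain ⟨m, hm⟩ := hrad
  refine ⟨p ^ m, hp.pow m, ?_⟩
  have h3 : Polynomial.aeval (Ideal.Quotient.mk (latIdeal X s) (chr γ)) (p ^ m) =
      Ideal.Quotient.mk (latIdeal X s) (Polynomial.aeval (chr γ) (p ^ m)) :=
    (Polynomial.aeval_algHom_apply (Ideal.Quotient.mkₐ ℤ (latIdeal X s)) (chr γ) (p ^ m))
  rw [← Polynomial.aeval_def, h3, map_pow, Ideal.Quotient.eq_zero_iff_mem.2 hm]

/-- A finitely generated algebra all of whose elements are integral is a finite module. -/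
instance finite_latQuot : Module.Finite ℤ (CharRing (lat s) ⧸ latIdeal X s) := by
  have : AddMonoid.FG (lat s) := AddGroup.fg_iff_addMonoid_fg.1
    (Module.Finite.iff_addGroup_fg.1 inferInstance)
  have : Algebra.FiniteType ℤ (CharRing (lat s)) := AddMonoidAlgebra.finiteType_of_fg ℤ (lat s)
  have : Algebra.FiniteType ℤ (CharRing (lat s) ⧸ latIdeal X s) :=
    Algebra.FiniteType.of_surjective (Ideal.Quotient.mkₐ ℤ (latIdeal X s))
      Ideal.Quotient.mk_surjective
  have : Algebra.IsIntegral ℤ (CharRing (lat s) ⧸ latIdeal X s) := by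
    refine ⟨fun x => ?_⟩
    obtain ⟨x, rfl⟩ := Ideal.Quotient.mk_surjective x
    induction x using AddMonoidAlgebra.induction_linear with
    | zero => rw [map_zero]; exact isIntegral_zero
    | add x y hx hy => rw [map_add]; exact hx.add hy
    | single γ c =>
      rw [single_eq_smul_chr, map_zsmul]
      exact (isIntegral_chr γ).smul c
  exact Algebra.IsIntegral.finite

/-- Because `latIdeal` is a contraction, the quotient embeds into R/J_s, whose torsion-freeness is
known. -/
instance isTorsionFree_latQuot :
    Module.IsTorsionFree ℤ (CharRing (lat s) ⧸ latIdeal X s) :=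
  Function.Injective.moduleIsTorsionFree
    (Ideal.quotientMap (cocircuitIdeal X s) (latIncl s) le_rfl)
    Ideal.quotientMap_injective fun c x => map_zsmul _ c x

instance free_latQuot : Module.Free ℤ (CharRing (lat s) ⧸ latIdeal X s) :=
  Module.free_of_finite_type_torsion_free'

end LatQuot

end

end DPV

namespace DPV

noncomputable section

/-! ### Functions killed by a cocircuit ideal, and their Ext groups. -/

section Killed

variable {Γ : Type u} [AddCommGroup Γ] {n : ℕ} (X : Fin n → Γ) (s : Submodule ℝ (ℝ ⊗[ℤ] Γ))

/-- The quotient of the character ring of the sublattice of `s` by the cocircuit ideal, as a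
module over the character ring of `Γ` by means of a retraction `ρ`. -/
def LatQuot (_ : Γ →ₗ[ℤ] lat s) : Type u := CharRing (lat s) ⧸ latIdeal X s

namespace LatQuot

variable (ρ : Γ →ₗ[ℤ] lat s)

instance : AddCommGroup (LatQuot X s ρ) :=
  inferInstanceAs (AddCommGroup (CharRing (lat s) ⧸ latIdeal X s))

instance : Module (CharRing Γ) (LatQuot X s ρ) :=
  Module.compHom (CharRing (lat s) ⧸ latIdeal X s)
    (AddMonoidAlgebra.mapDomainRingHom ℤ ρ.toAddMonoidHom)

instance [Module.Finite ℤ Γ] : Module.Finite ℤ (LatQuot X s ρ) :=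
  inferInstanceAs (Module.Finite ℤ (CharRing (lat s) ⧸ latIdeal X s))

instance [Module.Finite ℤ Γ] : Module.Free ℤ (LatQuot X s ρ) :=
  inferInstanceAs (Module.Free ℤ (CharRing (lat s) ⧸ latIdeal X s))

/-- The quotient map. -/
def mk : CharRing (lat s) →+ LatQuot X s ρ := (Ideal.Quotient.mk (latIdeal X s)).toAddMonoidHom

variable {X s}

theorem mk_surjective : Function.Surjective (mk X s ρ) := Ideal.Quotient.mk_surjective

theorem mk_eq_zero {r : CharRing (lat s)} : mk X s ρ r = 0 ↔ r ∈ latIdeal X s :=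
  Ideal.Quotient.eq_zero_iff_mem

theorem chr_smul_mk (γ : Γ) (r : CharRing (lat s)) :
    chr γ • mk X s ρ r = mk X s ρ (chr (ρ γ) * r) := by
  change Ideal.Quotient.mk (latIdeal X s) (AddMonoidAlgebra.mapDomain ρ (chr γ)) *
    Ideal.Quotient.mk (latIdeal X s) r = _
  rw [chr, AddMonoidAlgebra.mapDomain_single, ← map_mul]
  rfl

end LatQuot

/-- The functions supported on finitely many translates of `s` and killed by the cocircuit ideal
of `s`. -/
def killed : Submodule (CharRing Γ) (FunSpace Γ) where
  carrier := {g | g ∈ finTranslates s ∧ ∀ b ∈ cocircuitIdeal X s, b • g = 0}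
  zero_mem' := ⟨zero_mem _, fun _ _ => smul_zero _⟩
  add_mem' hf hg := ⟨add_mem hf.1 hg.1, fun b hb => by
    rw [smul_add, hf.2 b hb, hg.2 b hb, add_zero]⟩
  smul_mem' r f hf := ⟨Submodule.smul_mem _ r hf.1, fun b hb => by
    rw [smul_comm, hf.2 b hb, smul_zero]⟩

variable {X s}

/-- The projection to the quotient by the sublattice of `s`. -/
abbrev latProj (s : Submodule ℝ (ℝ ⊗[ℤ] Γ)) : Γ →+ Γ ⧸ lat s := (lat s).mkQ.toAddMonoidHom

theorem latProj_eq_zero {γ : Γ} : latProj s γ = 0 ↔ γ ∈ lat s :=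
  Submodule.Quotient.mk_eq_zero _

theorem latProj_surjective : Function.Surjective (latProj s) := Submodule.mkQ_surjective _

variable {ρ : Γ →ₗ[ℤ] lat s} (hρ : ∀ γ : lat s, ρ γ = γ)

/-- The section of the quotient map whose image is the kernel of the retraction. -/
def latSection : Γ ⧸ lat s →+ Γ :=
  ((lat s).liftQ (LinearMap.id - (lat s).subtype ∘ₗ ρ) fun γ hγ => by
    rw [LinearMap.mem_ker, LinearMap.sub_apply]
    change γ - (ρ γ : Γ) = 0
    rw [show ρ γ = ⟨γ, hγ⟩ from hρ ⟨γ, hγ⟩, sub_self]).toAddMonoidHom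

theorem latSection_latProj (γ : Γ) : latSection hρ (latProj s γ) = γ - ρ γ := rfl

theorem latProj_latSection (l : Γ ⧸ lat s) : latProj s (latSection hρ l) = l := by
  obtain ⟨γ, rfl⟩ := latProj_surjective l
  rw [latSection_latProj, map_sub (latProj s), latProj_eq_zero.2 (ρ γ).2, sub_zero]

theorem retraction_latSection (l : Γ ⧸ lat s) : ρ (latSection hρ l) = 0 := by
  obtain ⟨γ, rfl⟩ := latProj_surjective l
  rw [latSection_latProj, map_sub ρ, hρ, sub_self]

open LatQuot

section ToFun

variable (X ρ) in
/-- The function on `Γ` attached to a family of functionals. -/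
def toFunSpace : Twisted (latProj s) (IntDual (LatQuot X s ρ)) →ₗ[CharRing Γ] FunSpace Γ :=
  linearOfChr (AddMonoidHom.mk'
    -- The sign in `chr (-ρ x)` makes the transposed action on functionals correspond to translation
    -- by γ.
    (fun F x => F (latProj s x) (mk X s ρ (chr (-ρ x)))) fun _ _ => rfl) fun γ F =>
      FunSpace.ext fun x => by
        rw [chr_smul_apply]
        change (chr γ • F) (latProj s x) (mk X s ρ (chr (-ρ x))) =
          F (latProj s (x - γ)) (mk X s ρ (chr (-ρ (x - γ))))
        rw [Twisted.chr_smul_apply, IntDual.smul_apply, chr_smul_mk, ← chr_add, map_sub (latProj s),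
          map_sub ρ, neg_sub, sub_eq_add_neg (ρ γ)]

theorem toFunSpace_apply (F : Twisted (latProj s) (IntDual (LatQuot X s ρ))) (x : Γ) :
    toFunSpace X ρ F x = F (latProj s x) (mk X s ρ (chr (-ρ x))) := rfl

include hρ

theorem latIncl_smul_toFunSpace (b : CharRing (lat s))
    (F : Twisted (latProj s) (IntDual (LatQuot X s ρ))) (x : Γ) :
    (latIncl s b • toFunSpace X ρ F : FunSpace Γ) x =
      F (latProj s x) (mk X s ρ (b * chr (-ρ x))) := by
  induction b using AddMonoidAlgebra.induction_linear with
  | zero => rw [map_zero, zero_smul, zero_mul, map_zero, map_zero]; rfl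
  | add p q hp hq =>
    rw [map_add, add_smul, FunSpace.add_apply, hp, hq, add_mul, map_add, map_add]
  | single γ c =>
    rw [single_eq_smul_chr, map_zsmul, latIncl_chr, smul_assoc, smul_mul_assoc, map_zsmul,
      map_zsmul, ← chr_add]
    change c • (chr (γ : Γ) • toFunSpace X ρ F : FunSpace Γ) x = _
    rw [chr_smul_apply, toFunSpace_apply, map_sub (latProj s), map_sub ρ, latProj_eq_zero.2 γ.2, sub_zero, hρ,
      neg_sub, sub_eq_add_neg]

theorem toFunSpace_mem_killed (F : Twisted (latProj s) (IntDual (LatQuot X s ρ))) :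
    toFunSpace X ρ F ∈ killed X s := by
  refine ⟨?_, fun b hb => ?_⟩
  · rw [mem_finTranslates_iff]
    refine F.finite_support.subset ?_
    rintro _ ⟨x, hx, rfl⟩ h0
    apply hx
    rw [toFunSpace_apply]
    change F (latProj s x) = 0 at h0
    rw [h0]
    rfl
  · induction hb using Submodule.span_induction with
    | mem r hr =>
      obtain ⟨t, h1, h2, h3, rfl⟩ := hr
      refine FunSpace.ext fun x => ?_
      rw [← latIncl_latNabla, latIncl_smul_toFunSpace hρ, (mk_eq_zero ρ).2, map_zero]
      · rfl
      · exact Ideal.mul_mem_right _ _ (latNabla_mem_latIdeal h1 h2 h3)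
    | zero => rw [zero_smul]
    | add x y _ _ hx hy => rw [add_smul, hx, hy, add_zero]
    | smul r x _ hx => rw [smul_assoc, hx, smul_zero]

omit hρ in
theorem intDual_ext {φ ψ : IntDual (LatQuot X s ρ)}
    (h : ∀ γ : lat s, φ (mk X s ρ (chr γ)) = ψ (mk X s ρ (chr γ))) : φ = ψ := by
  refine IntDual.ext fun b => ?_
  obtain ⟨r, rfl⟩ := mk_surjective ρ b
  induction r using AddMonoidAlgebra.induction_linear with
  | zero => rw [map_zero, map_zero, map_zero]
  | add p q hp hq => rw [map_add, map_add, map_add, hp, hq]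
  | single γ c => rw [single_eq_smul_chr, map_zsmul, map_zsmul, map_zsmul, h]

theorem toFunSpace_injective : Function.Injective (toFunSpace X ρ) := by
  intro F F' h
  refine Twisted.ext fun l => intDual_ext fun γ => ?_
  have := congrFun h (latSection hρ l - γ)
  rw [toFunSpace_apply, toFunSpace_apply, map_sub (latProj s), map_sub ρ, latProj_latSection,
    retraction_latSection, latProj_eq_zero.2 γ.2, hρ, sub_zero, zero_sub, neg_neg] at this
  exact this

/-- On each coset of `lat s`, acting on g by elements of the small character ring and evaluating at
a base point is a functional. It descends to the quotient because g is killed, and it vanishes on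
all but finitely many cosets. -/
theorem exists_toFunSpace_eq {g : FunSpace Γ} (hg : g ∈ killed X s) :
    ∃ F, toFunSpace X ρ F = g := by
  let φ₀ (l : Γ ⧸ lat s) : CharRing (lat s) →+ ℤ := AddMonoidHom.mk'
    (fun r => (latIncl s r • g : FunSpace Γ) (latSection hρ l)) fun r r' => by
      rw [map_add, add_smul]
      rfl
  let φ (l : Γ ⧸ lat s) : LatQuot X s ρ →+ ℤ :=
    QuotientAddGroup.lift (latIdeal X s).toAddSubgroup (φ₀ l) fun r hr => by
      change (latIncl s r • g : FunSpace Γ) (latSection hρ l) = 0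
      rw [hg.2 _ hr]
      rfl
  let φ' (l : Γ ⧸ lat s) : IntDual (LatQuot X s ρ) := (φ l).toIntLinearMap
  have hφ (l : Γ ⧸ lat s) (γ : lat s) :
      φ' l (mk X s ρ (chr γ)) = g (latSection hρ l - γ) := by
    change (latIncl s (chr γ) • g : FunSpace Γ) (latSection hρ l) = _
    rw [latIncl_chr, chr_smul_apply]
  have hfin : {l | φ' l ≠ 0}.Finite := by
    refine (mem_finTranslates_iff.1 hg.1).subset fun l hl => ?_
    by_contra hc
    refine hl (intDual_ext fun γ => ?_)
    rw [hφ, IntDual.zero_apply]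
    by_contra hne
    refine hc ⟨_, hne, ?_⟩
    change latProj s _ = l
    rw [map_sub, latProj_latSection, latProj_eq_zero.2 γ.2, sub_zero]
  refine ⟨Twisted.ofFun φ' hfin, FunSpace.ext fun x => ?_⟩
  rw [toFunSpace_apply, Twisted.ofFun_apply, hφ, latSection_latProj]
  congr 1
  push_cast
  abel

/-- The functions killed by the cocircuit ideal of `s` form a twisted module. -/
def killedEquiv : Twisted (latProj s) (IntDual (LatQuot X s ρ)) ≃ₗ[CharRing Γ] killed X s :=
  LinearEquiv.ofBijective
    (LinearMap.codRestrict (killed X s) (toFunSpace X ρ) (toFunSpace_mem_killed hρ))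
    ⟨fun _ _ h => toFunSpace_injective hρ (congrArg Subtype.val h),
      fun g => (exists_toFunSpace_eq hρ g.2).imp fun _ h => Subtype.ext h⟩

end ToFun

section Quotient

variable (X ρ) in
/-- The orbit map of the generator of the twisted module. -/
def orbitMap : CharRing Γ →ₗ[CharRing Γ] Twisted (latProj s) (LatQuot X s ρ) :=
  LinearMap.toSpanSingleton _ _ (Twisted.single _ 0 (mk X s ρ 1))

theorem orbitMap_chr (γ : Γ) :
    orbitMap X ρ (chr γ) = Twisted.single _ (latProj s γ) (mk X s ρ (chr (ρ γ))) := by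
  rw [orbitMap, LinearMap.toSpanSingleton_apply, Twisted.chr_smul_single, chr_smul_mk, mul_one,
    add_zero]

include hρ

theorem orbitMap_surjective : Function.Surjective (orbitMap X ρ) := by
  rw [← LinearMap.range_eq_top, Submodule.eq_top_iff']
  intro F
  induction F using Twisted.induction_on with
  | zero => exact zero_mem _
  | add F F' h h' => exact add_mem h h'
  | sing l b =>
    obtain ⟨r, rfl⟩ := mk_surjective ρ b
    induction r using AddMonoidAlgebra.induction_linear with
    | zero => rw [map_zero, map_zero]; exact zero_mem _
    | add p q hp hq => rw [map_add, map_add]; exact add_mem hp hq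
    | single γ c =>
      rw [single_eq_smul_chr, map_zsmul, map_zsmul]
      have h : Twisted.single _ l (mk X s ρ (chr γ)) ∈ LinearMap.range (orbitMap X ρ) :=
        ⟨chr (latSection hρ l + γ), by
          rw [orbitMap_chr, map_add, map_add, latProj_latSection, retraction_latSection,
            latProj_eq_zero.2 γ.2, hρ, add_zero, zero_add]⟩
      exact zsmul_mem h c

theorem orbitMap_latIncl (b : CharRing (lat s)) :
    orbitMap X ρ (latIncl s b) = Twisted.single _ 0 (mk X s ρ b) := by
  induction b using AddMonoidAlgebra.induction_linear with
  | zero => simp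
  | add p q hp hq => rw [map_add, map_add, map_add, map_add, hp, hq]
  | single γ c =>
    rw [single_eq_smul_chr, map_zsmul, map_zsmul, map_zsmul, map_zsmul, latIncl_chr, orbitMap_chr,
      latProj_eq_zero.2 γ.2, hρ]

/-- The inverse of the orbit map. -/
def orbitInv : Twisted (latProj s) (LatQuot X s ρ) →+ CharRing Γ ⧸ cocircuitIdeal X s :=
  Twisted.lift fun l => QuotientAddGroup.lift (latIdeal X s).toAddSubgroup
    (AddMonoidHom.mk' (fun r => Ideal.Quotient.mk (cocircuitIdeal X s)
      (chr (latSection hρ l) * latIncl s r)) fun r r' => by rw [map_add, mul_add, map_add])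
    fun r hr => Ideal.Quotient.eq_zero_iff_mem.2 (Ideal.mul_mem_left _ _ hr)

theorem orbitInv_single (l : Γ ⧸ lat s) (r : CharRing (lat s)) :
    orbitInv hρ (Twisted.single _ l (mk X s ρ r)) =
      Ideal.Quotient.mk (cocircuitIdeal X s) (chr (latSection hρ l) * latIncl s r) :=
  Twisted.lift_single _ _ _

theorem orbitInv_orbitMap (c : CharRing Γ) :
    orbitInv hρ (orbitMap X ρ c) = Ideal.Quotient.mk (cocircuitIdeal X s) c := by
  induction c using AddMonoidAlgebra.induction_linear with
  | zero => simp
  | add p q hp hq => rw [map_add, map_add, map_add, hp, hq]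
  | single γ c =>
    rw [single_eq_smul_chr, map_zsmul, map_zsmul, map_zsmul, orbitMap_chr, orbitInv_single,
      latIncl_chr, ← chr_add, latSection_latProj, sub_add_cancel]

/-- The generators of the cocircuit ideal come from the character ring of `lat s` and die at the
origin; conversely, `orbitInv` recovers the class of c modulo the ideal from its orbit. -/
theorem ker_orbitMap : LinearMap.ker (orbitMap X ρ) = cocircuitIdeal X s := by
  apply le_antisymm
  · intro c hc
    rw [← Ideal.Quotient.eq_zero_iff_mem, ← orbitInv_orbitMap hρ, LinearMap.mem_ker.1 hc, map_zero]
  · rw [cocircuitIdeal, relJ, Ideal.span, Submodule.span_le]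
    rintro _ ⟨t, h1, h2, h3, rfl⟩
    rw [SetLike.mem_coe, LinearMap.mem_ker, ← latIncl_latNabla, orbitMap_latIncl hρ,
      (mk_eq_zero ρ).2 (latNabla_mem_latIdeal h1 h2 h3), map_zero]

/-- The quotient by the cocircuit ideal is a twisted module. -/
def quotientEquiv :
    Twisted (latProj s) (LatQuot X s ρ) ≃ₗ[CharRing Γ] CharRing Γ ⧸ cocircuitIdeal X s :=
  ((Submodule.quotEquivOfEq _ _ (ker_orbitMap hρ)).symm.trans
    ((orbitMap X ρ).quotKerEquivOfSurjective (orbitMap_surjective hρ))).symm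

end Quotient

variable [Module.Free ℤ Γ] [Module.Finite ℤ Γ]

omit [Module.Free ℤ Γ] in
/-- The quotient by the cocircuit ideal is free over the integers. -/
theorem free_quotient_cocircuitIdeal (X : Fin n → Γ) (s : Submodule ℝ (ℝ ⊗[ℤ] Γ)) :
    Module.Free ℤ (CharRing Γ ⧸ cocircuitIdeal X s) := by
  obtain ⟨ρ, hρ⟩ := exists_retraction s
  have : Module.Free ℤ (Twisted (latProj s) (LatQuot X s ρ)) :=
    inferInstanceAs (Module.Free ℤ (Γ ⧸ lat s →₀ LatQuot X s ρ))
  exact Module.Free.of_equiv (quotientEquiv (X := X) hρ).toAddEquiv.toIntLinearEquiv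

/-- For rational s the lattice `lat s` has rank dim s, so dividing out a basis of it takes exactly
that many degree shifts. -/
theorem isExtDual_twisted (hs : IsRational X s) (ρ : Γ →ₗ[ℤ] lat s) :
    IsExtDual (Twisted (latProj s) (IntDual (LatQuot X s ρ)))
      (Twisted (latProj s) (LatQuot X s ρ)) (Module.finrank ℝ s)
      (Twisted.shift _ _) (Twisted.shift _ _) := by
  let b := Module.finBasisOfFinrankEq ℤ (lat s) hs.finrank_lat
  have hb : LinearIndependent ℤ (Subtype.val ∘ b) :=
    b.linearIndependent.map' (lat s).subtype (Submodule.ker_subtype _)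
  have hspan : Submodule.span ℤ (Set.range (Subtype.val ∘ b)) = lat s := by
    rw [Set.range_comp]
    change Submodule.span ℤ ((lat s).subtype '' Set.range b) = lat s
    rw [Submodule.span_image, b.span_eq, Submodule.map_top, Submodule.range_subtype]
  have key := Twisted.isExtDual_span (B := LatQuot X s ρ) _ hb
  rw [hspan] at key
  exact key

theorem subsingleton_extRing_killed (hs : IsRational X s) (q : ℕ) (hq : q ≠ Module.finrank ℝ s) :
    Subsingleton (ExtRing (CharRing Γ) (killed X s) q) := by
  obtain ⟨ρ, hρ⟩ := exists_retraction s
  have := (isExtDual_twisted hs ρ).subsingleton q hq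
  exact (extEquiv (killedEquiv (X := X) hρ) q).toEquiv.subsingleton

/-- The auxiliary retraction disappears: with the same ρ, the killed functions are the twisted
module of the dual, and R/J_s is the twisted module it is dual to. -/
theorem nonempty_extRing_killed_equiv (hs : IsRational X s) :
    Nonempty (ExtRing (CharRing Γ) (killed X s) (Module.finrank ℝ s) ≃ₗ[CharRing Γ]
      CharRing Γ ⧸ cocircuitIdeal X s) := by
  obtain ⟨ρ, hρ⟩ := exists_retraction s
  obtain ⟨α, -⟩ := (isExtDual_twisted hs ρ).exists_equiv
  exact ⟨((extEquiv (killedEquiv (X := X) hρ) _).trans α).trans (quotientEquiv hρ)⟩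

end Killed

end

end DPV

namespace DPV

noncomputable section

/-! ### The filtration of the dual module and its graded pieces. -/

section Graded

variable {Γ : Type u} [AddCommGroup Γ] {n : ℕ} (X : Fin n → Γ)

/-- The relation forces c s to annihilate all functions killed by the cocircuit ideal of s; as the
quotient by that ideal is free over ℤ, integral functionals then show that c s vanishes in it. -/
theorem mem_cocircuitIdeal_of_sum_mem [Module.Finite ℤ Γ] {X : Fin n → Γ} {k : ℕ}
    {c : RatDim X ⊤ k → CharRing Γ} (h : ∑ s, c s * nablaCompl X s.1 ∈ idealJ X k)
    (s : RatDim X ⊤ k) : c s ∈ cocircuitIdeal X s.1 := by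
  -- The natural number 0 is used as modulus, so that `ZMod 0` is ℤ and divisibility means
  -- vanishing.
  have hann : ∀ g ∈ finTranslates s.1,
      (∀ b ∈ cocircuitIdeal X s.1, b • g ∈ divBy Γ ((0 : ℕ) : ℤ)) →
      c s • g ∈ divBy Γ ((0 : ℕ) : ℤ) := fun g hg hgJ =>
    smul_mem_divBy_of_sum_eq (fun t : RatDim X ⊤ k => t.1) Subtype.val_injective
      (fun t => t.2.2.2) c (N := ((0 : ℕ) : ℤ)) (r := 0) h (by rw [mul_zero, zero_add]) s hg hgJ
  have := free_quotient_cocircuitIdeal X s.1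
  rw [← Ideal.Quotient.eq_zero_iff_mem]
  refine (Module.forall_dual_apply_eq_zero_iff ℤ _).1 fun ψ => ?_
  refine apply_eq_zero_of_annihilates hann
    (ψ.toAddMonoidHom.comp (Ideal.Quotient.mk (cocircuitIdeal X s.1)).toAddMonoidHom) fun b hb => ?_
  change ψ (Ideal.Quotient.mk _ b) = 0
  rw [Ideal.Quotient.eq_zero_iff_mem.2 hb, map_zero]

/-- The combination of the elements `∇_{X \ s}`, for `s` rational of dimension `k`. -/
def nablaSum (k : ℕ) : (RatDim X ⊤ k → CharRing Γ) →ₗ[CharRing Γ] CharRing Γ :=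
  Fintype.linearCombination (CharRing Γ) fun s : RatDim X ⊤ k => nablaCompl X s.1

theorem nablaSum_apply (k : ℕ) (c : RatDim X ⊤ k → CharRing Γ) :
    nablaSum X k c = ∑ s, c s * nablaCompl X s.1 := rfl

variable {X}

theorem nablaSum_mem_idealJ_iff [Module.Finite ℤ Γ] {k : ℕ} {c : RatDim X ⊤ k → CharRing Γ} :
    nablaSum X k c ∈ idealJ X k ↔ ∀ s, c s ∈ cocircuitIdeal X s.1 := by
  refine ⟨mem_cocircuitIdeal_of_sum_mem, fun h => ?_⟩
  rw [nablaSum_apply]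
  refine sum_mem fun s _ => ?_
  rw [mul_comm]
  refine nablaCompl_mul_mem_idealJ ?_
  have := h s
  rwa [cocircuitIdeal, s.2.2.2] at this

theorem mem_idealJ_succ {k : ℕ} {x : CharRing Γ} :
    x ∈ idealJ X (k + 1) ↔ ∃ c, ∃ j ∈ idealJ X k, nablaSum X k c + j = x := by
  rw [← relJ_top, mem_relJ_succ, relJ_top]
  simp only [nablaRel_top]
  rfl

variable (X) in
/-- The filtration of the dual module by the images of the ideals `J_m`. -/
def dualFiltration (i m : ℕ) : Submodule (CharRing Γ) (dualDPV X i) :=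
  Submodule.map (idealJ X i).mkQ (idealJ X m)

theorem mk_mem_dualFiltration {i m : ℕ} (h : i ≤ m) {x : CharRing Γ} :
    (idealJ X i).mkQ x ∈ dualFiltration X i m ↔ x ∈ idealJ X m := by
  refine ⟨?_, fun hx => ⟨x, hx, rfl⟩⟩
  rintro ⟨y, hy, hyx⟩
  have h1 : y - x ∈ idealJ X i := (Submodule.Quotient.eq _).1 hyx
  have := sub_mem hy (idealJ_mono h h1)
  rwa [sub_sub_cancel] at this

/-- The map to the graded piece. -/
def gradedMap (i k : ℕ) : (RatDim X ⊤ k → CharRing Γ) →ₗ[CharRing Γ]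
    dualFiltration X i (k + 1) ⧸
      (dualFiltration X i k).submoduleOf (dualFiltration X i (k + 1)) :=
  Submodule.mkQ _ ∘ₗ LinearMap.codRestrict (dualFiltration X i (k + 1))
    ((idealJ X i).mkQ ∘ₗ nablaSum X k)
    fun c => ⟨_, mem_idealJ_succ.2 ⟨c, 0, zero_mem _, add_zero _⟩, rfl⟩

theorem gradedMap_surjective (i k : ℕ) : Function.Surjective (gradedMap (X := X) i k) := by
  intro y
  obtain ⟨⟨_, x, hx, rfl⟩, rfl⟩ := Submodule.mkQ_surjective _ y
  obtain ⟨c, j, hj, rfl⟩ := mem_idealJ_succ.1 hx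
  refine ⟨c, (Submodule.Quotient.eq _).2 ?_⟩
  change (idealJ X i).mkQ (nablaSum X k c) - (idealJ X i).mkQ (nablaSum X k c + j) ∈
    dualFiltration X i k
  rw [← map_sub, sub_add_cancel_left]
  exact ⟨_, neg_mem hj, rfl⟩

/-- The condition i ≤ k places J_i inside J_k, so membership may be tested in R before dividing by
J_i. -/
theorem ker_gradedMap [Module.Finite ℤ Γ] {i k : ℕ} (h : i ≤ k) :
    LinearMap.ker (gradedMap (X := X) i k) =
      Submodule.pi Set.univ fun s : RatDim X ⊤ k => cocircuitIdeal X s.1 := by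
  ext c
  rw [LinearMap.mem_ker, gradedMap, LinearMap.comp_apply, Submodule.mkQ_apply,
    Submodule.Quotient.mk_eq_zero]
  change (idealJ X i).mkQ (nablaSum X k c) ∈ dualFiltration X i k ↔ _
  rw [mk_mem_dualFiltration h, nablaSum_mem_idealJ_iff, Submodule.mem_pi]
  exact ⟨fun h s _ => h s, fun h s => h s trivial⟩

/-- The graded pieces of the filtration. -/
def gradedEquiv [Module.Finite ℤ Γ] {i k : ℕ} (h : i ≤ k) :
    (dualFiltration X i (k + 1) ⧸
      (dualFiltration X i k).submoduleOf (dualFiltration X i (k + 1))) ≃ₗ[CharRing Γ]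
    ∀ s : RatDim X ⊤ k, CharRing Γ ⧸ cocircuitIdeal X s.1 := by
  classical
  exact ((gradedMap i k).quotKerEquivOfSurjective (gradedMap_surjective i k)).symm.trans
    ((Submodule.quotEquivOfEq _ _ (ker_gradedMap h)).trans
      (Submodule.quotientPi fun s : RatDim X ⊤ k => cocircuitIdeal X s.1))

theorem dualFiltration_self (i : ℕ) : dualFiltration X i i = ⊥ := by
  rw [dualFiltration, eq_bot_iff, Submodule.map_le_iff_le_comap]
  intro x hx
  exact (Submodule.Quotient.mk_eq_zero _).2 hx

theorem dualFiltration_mono {i m m' : ℕ} (h : m ≤ m') :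
    dualFiltration X i m ≤ dualFiltration X i m' := Submodule.map_mono (idealJ_mono h)

/-- The augmentation kills every ∇_a. Each generator of the ideal has at least one such factor,
since a subspace of smaller dimension cannot contain the vectors of X spanning s; so 1 is not in the
ideal. -/
theorem nontrivial_quotient_cocircuitIdeal [Module.Finite ℤ Γ]
    {s : Submodule ℝ (ℝ ⊗[ℤ] Γ)} (hs : IsRational X s) :
    Nontrivial (CharRing Γ ⧸ cocircuitIdeal X s) := by
  classical
  refine Ideal.Quotient.nontrivial_iff.2 fun htop => ?_
  let ε : CharRing Γ →+* ℤ := (AddMonoidAlgebra.lift ℤ ℤ Γ 1).toRingHom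
  have hε (a : Γ) : ε (nabla a) = 0 := by
    change AddMonoidAlgebra.lift ℤ ℤ Γ 1 (1 - AddMonoidAlgebra.single a 1) = 0
    rw [map_sub, map_one, AddMonoidAlgebra.lift_single]
    simp
  have hle : cocircuitIdeal X s ≤ RingHom.ker ε := by
    rw [cocircuitIdeal, relJ, Ideal.span_le]
    rintro _ ⟨t, -, -, hlt, rfl⟩
    obtain ⟨A, rfl⟩ := hs
    have : ∃ k ∈ A, toV (X k) ∉ t := by
      by_contra! hc
      have hle : Submodule.span ℝ ((fun k => toV (X k)) '' A) ≤ t := by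
        rw [Submodule.span_le]
        rintro _ ⟨k, hk, rfl⟩
        exact hc k hk
      exact hlt.not_ge (Submodule.finrank_mono hle)
    obtain ⟨k, hk, hkt⟩ := this
    rw [SetLike.mem_coe, RingHom.mem_ker, nablaRel, map_prod]
    exact Finset.prod_eq_zero (Finset.mem_filter.2 ⟨Finset.mem_univ k,
      Submodule.subset_span ⟨k, hk, rfl⟩, hkt⟩) (hε _)
  have := hle (htop ▸ Submodule.mem_top : (1 : CharRing Γ) ∈ cocircuitIdeal X s)
  rw [RingHom.mem_ker, map_one] at this
  exact one_ne_zero this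

end Graded

/-! ### The strata of the function modules and their Ext groups. -/

section Strata

variable {Γ : Type u} [AddCommGroup Γ] {n : ℕ} (X : Fin n → Γ)

/-- The functions killed by `∇_{X \ s}` for `s` rational of dimension `< k`, while `∇_{X \ s} f` is
supported on finitely many translates of `s` for the other rational subspaces `s`. -/
def strata (k : ℕ) : Submodule (CharRing Γ) (FunSpace Γ) where
  carrier := {f | ∀ s : Submodule ℝ (ℝ ⊗[ℤ] Γ), IsRational X s →
    (Module.finrank ℝ s < k → nablaCompl X s • f = 0) ∧
    (k ≤ Module.finrank ℝ s → nablaCompl X s • f ∈ finTranslates s)}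
  zero_mem' s _ := by simp
  add_mem' {f g} hf hg s hs := by
    refine ⟨fun h => ?_, fun h => ?_⟩
    · rw [smul_add, (hf s hs).1 h, (hg s hs).1 h, add_zero]
    · rw [smul_add]
      exact add_mem ((hf s hs).2 h) ((hg s hs).2 h)
  smul_mem' r f hf s hs := by
    refine ⟨fun h => ?_, fun h => ?_⟩
    · rw [smul_comm, (hf s hs).1 h, smul_zero]
    · rw [smul_comm]
      exact Submodule.smul_mem _ r ((hf s hs).2 h)

variable {X}

theorem strata_succ_le (k : ℕ) : strata X (k + 1) ≤ strata X k := by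
  intro f hf s hs
  refine ⟨fun h => (hf s hs).1 (by omega), fun h => ?_⟩
  rcases h.lt_or_eq with h | h
  · exact (hf s hs).2 h
  · rw [(hf s hs).1 (by omega)]
    exact zero_mem _

variable [Module.Finite ℤ Γ]

omit [Module.Finite ℤ Γ] in
-- For k at most the rank, V itself has dimension at least k, so the properness condition on s is
-- automatic.
theorem dpv_eq_strata [Module.Free ℤ Γ] {k : ℕ} (hk : k ≤ Module.finrank ℤ Γ) :
    dpv X k = strata X k := by
  ext f
  refine forall₂_congr fun s _ => ?_
  have : s ≠ ⊤ ∧ Module.finrank ℝ s < k ↔ Module.finrank ℝ s < k := by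
    refine and_iff_right_of_imp ?_
    rintro h rfl
    rw [finrank_top, finrank_V] at h
    omega
  rw [this, not_lt]

/-- V is rational of dimension the rank of Γ, and its condition reads 1 • f = 0. -/
theorem strata_eq_bot [Module.Free ℤ Γ]
    (hrank : Module.finrank ℤ (Submodule.span ℤ (Set.range X)) = Module.finrank ℤ Γ) :
    strata X (Module.finrank ℤ Γ + 1) = ⊥ := by
  rw [eq_bot_iff]
  intro f hf
  have := (hf ⊤ ⟨Set.univ, by rw [Set.image_univ, span_range_toV hrank]⟩).1
    (by rw [finrank_top, finrank_V]; omega)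
  rwa [nablaCompl_top, one_smul] at this

omit [Module.Finite ℤ Γ] in
theorem nablaCompl_smul_mem_killed {k : ℕ} {f : FunSpace Γ} (hf : f ∈ strata X k)
    (s : RatDim X ⊤ k) : nablaCompl X s.1 • f ∈ killed X s.1 := by
  refine ⟨(hf s.1 s.2.1).2 s.2.2.2.ge, fun b hb => ?_⟩
  induction hb using Submodule.span_induction with
  | mem r hr =>
    obtain ⟨t, h1, h2, h3, rfl⟩ := hr
    rw [smul_smul, mul_comm, nablaCompl_mul_nablaRel X h2]
    exact (hf t h1).1 (h3.trans_eq s.2.2.2)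
  | zero => rw [zero_smul]
  | add x y _ _ hx hy => rw [add_smul, hx, hy, add_zero]
  | smul r x _ hx => rw [smul_assoc, hx, smul_zero]

variable (X) in
omit [Module.Finite ℤ Γ] in
/-- The map from a stratum to the modules attached to the subspaces of dimension `k`. -/
def strataMap (k : ℕ) : strata X k →ₗ[CharRing Γ] ∀ s : RatDim X ⊤ k, killed X s.1 :=
  LinearMap.pi fun s => LinearMap.codRestrict (killed X s.1)
    (nablaCompl X s.1 • (strata X k).subtype) fun f => nablaCompl_smul_mem_killed f.2 s

omit [Module.Finite ℤ Γ] in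
theorem coe_strataMap (k : ℕ) (f : strata X k) (s : RatDim X ⊤ k) :
    (strataMap X k f s : FunSpace Γ) = nablaCompl X s.1 • (f : FunSpace Γ) := rfl

/-- The series solution f works: subspaces not containing s have ∇ in the cocircuit ideal, which
kills g and hence f, while those containing s have dimension at least k, with equality only for s
itself. -/
theorem exists_mem_strata {k : ℕ} (s : RatDim X ⊤ k) {g : FunSpace Γ} (hg : g ∈ killed X s.1) :
    ∃ f ∈ strata X k, nablaCompl X s.1 • f = g ∧
      ∀ t : RatDim X ⊤ k, t ≠ s → nablaCompl X t.1 • f = 0 := by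
  obtain ⟨f, h1, h2, h3⟩ := exists_nablaCompl_smul_eq X hg.1
  have h0 (t : Submodule ℝ (ℝ ⊗[ℤ] Γ)) (ht : ¬ s.1 ≤ t) : nablaCompl X t • f = 0 :=
    mem_divBy_zero.1 (h3 0 _ (mem_divBy_zero.2 (hg.2 _ (nablaCompl_mem_cocircuitIdeal ht))))
  refine ⟨f, fun t _ => ⟨fun h => h0 t fun hle => ?_, fun _ => ?_⟩, h1, fun t ht => h0 t.1 ?_⟩
  · have := Submodule.finrank_mono hle
    rw [s.2.2.2] at this
    omega
  · by_cases hle : s.1 ≤ t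
    · exact h2 t hle
    · rw [h0 t hle]
      exact zero_mem _
  · intro hle
    exact ht (Subtype.ext
      (Submodule.eq_of_le_of_finrank_eq hle (s.2.2.2.trans t.2.2.2.symm)).symm)

theorem strataMap_surjective (k : ℕ) : Function.Surjective (strataMap X k) := by
  classical
  intro g
  choose f hf h1 h2 using fun s : RatDim X ⊤ k => exists_mem_strata s (g s).2
  refine ⟨⟨∑ s, f s, sum_mem fun s _ => hf s⟩, funext fun t => Subtype.ext ?_⟩
  rw [coe_strataMap]
  change nablaCompl X t.1 • ∑ s, f s = _
  rw [Finset.smul_sum, Finset.sum_eq_single t (fun s _ hs => h2 s t hs.symm) (by simp), h1]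

omit [Module.Finite ℤ Γ] in
theorem exact_strataMap (k : ℕ) :
    Function.Exact (Submodule.inclusion (strata_succ_le (X := X) k)) (strataMap X k) := by
  intro f
  constructor
  · intro h
    refine ⟨⟨f, fun s hs => ⟨fun hlt => ?_, fun hle => (f.2 s hs).2 (by omega)⟩⟩, rfl⟩
    rcases (Nat.lt_succ_iff.1 hlt).lt_or_eq with hlt | heq
    · exact (f.2 s hs).1 hlt
    · exact congrArg Subtype.val (congrFun h ⟨s, hs, le_top, heq⟩)
  · rintro ⟨f, rfl⟩
    refine funext fun s => Subtype.ext ?_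
    exact (f.2 s.1 s.2.1).1 (s.2.2.2.trans_lt (Nat.lt_succ_self k))

variable [Module.Free ℤ Γ]

theorem subsingleton_extRing_pi_killed {k q : ℕ} (h : q ≠ k) :
    Subsingleton (ExtRing (CharRing Γ) (∀ s : RatDim X ⊤ k, killed X s.1) q) := by
  classical
  have (s : RatDim X ⊤ k) : Subsingleton (ExtRing (CharRing Γ) (killed X s.1) q) :=
    subsingleton_extRing_killed s.2.1 q (by rwa [s.2.2.2])
  exact (extPiEquiv (fun s : RatDim X ⊤ k => killed X s.1) _
    (LinearEquiv.refl _ _) q).toEquiv.subsingleton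

theorem nonempty_extRing_pi_killed_equiv (k : ℕ) :
    Nonempty (ExtRing (CharRing Γ) (∀ s : RatDim X ⊤ k, killed X s.1) k ≃ₗ[CharRing Γ]
      ∀ s : RatDim X ⊤ k, CharRing Γ ⧸ cocircuitIdeal X s.1) := by
  classical
  have (s : RatDim X ⊤ k) : Nonempty (ExtRing (CharRing Γ) (killed X s.1) k ≃ₗ[CharRing Γ]
      CharRing Γ ⧸ cocircuitIdeal X s.1) := by
    have := nonempty_extRing_killed_equiv s.2.1
    rwa [s.2.2.2] at this
  exact ⟨(extPiEquiv (fun s : RatDim X ⊤ k => killed X s.1) _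
    (LinearEquiv.refl _ _) k).trans (LinearEquiv.piCongrRight fun s => (this s).some)⟩

/-- The Ext groups of the strata. -/
theorem extRing_strata
    (hrank : Module.finrank ℤ (Submodule.span ℤ (Set.range X)) = Module.finrank ℤ Γ)
    {k : ℕ} (hk : k ≤ Module.finrank ℤ Γ + 1) :
    (∀ q < k, Subsingleton (ExtRing (CharRing Γ) (strata X k) q)) ∧
      ∀ q, k ≤ q → Nonempty (ExtRing (CharRing Γ) (strata X k) q ≃ₗ[CharRing Γ]
        ∀ s : RatDim X ⊤ q, CharRing Γ ⧸ cocircuitIdeal X s.1) := by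
  induction hk using Nat.decreasingInduction with
  | self =>
    have : Subsingleton (strata X (Module.finrank ℤ Γ + 1)) := by
      rw [strata_eq_bot hrank]
      infer_instance
    have hsub (q : ℕ) := subsingleton_extRing_of_subsingleton (R := CharRing Γ)
      (M := strata X (Module.finrank ℤ Γ + 1)) q
    refine ⟨fun q _ => hsub q, fun q hq => ⟨?_⟩⟩
    have := hsub q
    have : IsEmpty (RatDim X ⊤ q) := ⟨fun s => by
      have h := Submodule.finrank_le s.1
      rw [s.2.2.2, finrank_V] at h
      omega⟩
    -- Above the rank there are no rational subspaces, so both modules are zero and the zero map is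
    -- an equivalence.
    exact 0
  | of_succ k _ ih =>
    obtain ⟨ih1, ih2⟩ := ih
    have hinj := Submodule.inclusion_injective (strata_succ_le (X := X) k)
    have hsurj := strataMap_surjective (X := X) k
    have hex := exact_strataMap (X := X) k
    set ι := Submodule.inclusion (strata_succ_le (X := X) k)
    have hpi {q : ℕ} (hq : q ≠ k) :
        Subsingleton (ExtRing (CharRing Γ) (∀ s : RatDim X ⊤ k, killed X s.1) q) :=
      subsingleton_extRing_pi_killed hq
    -- The next stratum has no Ext in degrees up to k, so there all Ext of the current stratum comes
    -- from the killed functions.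
    have hπ (q : ℕ) (hq : q ≤ k) : Function.Surjective (extMap (strataMap X k) q) := fun ξ =>
      have := ih1 q (by omega)
      (exact_extMap_extMap hinj hsurj hex q ξ).1 (Subsingleton.elim _ _)
    refine ⟨fun q hq => ?_, fun q hq => ?_⟩
    · have := hpi hq.ne
      exact (hπ q hq.le).subsingleton
    rcases hq.eq_or_lt with rfl | hq
    -- In degree k the kernel comes from Ext of degree k - 1 of the next stratum, which vanishes; in
    -- degree 0 surjectivity of `strataMap` is used instead.
    · have hinj' : Function.Injective (extMap (strataMap X k) k) := by
        rw [injective_iff_map_eq_zero]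
        intro ξ h0
        obtain rfl | ⟨q, rfl⟩ : k = 0 ∨ ∃ q, k = q + 1 := by
          rcases k with _ | q
          · exact Or.inl rfl
          · exact Or.inr ⟨q, rfl⟩
        · rw [← map_zero (extMap (strataMap X 0) 0)] at h0
          exact CategoryTheory.Abelian.Ext.precomp_mk₀_injective_of_epi
            (hg := (ModuleCat.epi_iff_surjective _).2 hsurj) _
            (ModuleCat.ofHom (strataMap X 0)) h0
        · have := ih1 q (by omega)
          obtain ⟨η, rfl⟩ := (exact_extConn_extMap hinj hsurj hex q ξ).1 h0
          rw [Subsingleton.elim η 0, map_zero]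
      obtain ⟨e⟩ := nonempty_extRing_pi_killed_equiv (X := X) k
      exact ⟨(LinearEquiv.ofBijective _ ⟨hinj', hπ k le_rfl⟩).symm.trans e⟩
    -- Above k the killed functions contribute nothing in degrees q and q + 1, so restriction to the
    -- next stratum is an isomorphism.
    · have h1 := hpi (q := q) (by omega)
      have h2 := hpi (q := q + 1) (by omega)
      have hbij : Function.Bijective (extMap ι q) := by
        refine ⟨(injective_iff_map_eq_zero _).2 fun ξ h0 => ?_, fun ξ =>
          (exact_extMap_extConn hinj hsurj hex q ξ).1 (Subsingleton.elim _ _)⟩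
        obtain ⟨η, rfl⟩ := (exact_extMap_extMap hinj hsurj hex q ξ).1 h0
        rw [Subsingleton.elim η 0, map_zero]
      exact ⟨(LinearEquiv.ofBijective _ hbij).trans (ih2 q hq).some⟩

end Strata

end

end DPV

/-! ### Assembling the filtration. -/

theorem mainTheorem6 {Γ : Type u} [AddCommGroup Γ] [Module.Free ℤ Γ] [Module.Finite ℤ Γ]
    (d : ℕ) (hd : Module.finrank ℤ Γ = d) {n : ℕ} (X : Fin n → Γ)
    (hrank : Module.finrank ℤ (Submodule.span ℤ (Set.range X)) = Module.finrank ℤ Γ)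
    (hne : ∀ k, DPV.toV (X k) ≠ 0) (i : ℕ) (hi : i ≤ d) :
    (∃ F : ℕ → Submodule (DPV.CharRing Γ) (DPV.dualDPV X i),
      F i = ⊤ ∧ F (d + 1) = ⊥ ∧
      ∀ j, i ≤ j → j ≤ d →
        F (j + 1) < F j ∧
        Nonempty ((F j ⧸ (F (j + 1)).submoduleOf (F j)) ≃ₗ[DPV.CharRing Γ]
          DPV.extDPV X i (d - j + i))) ∧
    ∀ k, Nontrivial (DPV.extDPV X i k) ↔ i ≤ k ∧ k ≤ d := by
  subst hd
  obtain ⟨hlt, hge⟩ := DPV.extRing_strata (X := X) hrank (k := i) (by omega)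
  rw [← DPV.dpv_eq_strata hi] at hlt hge
  have hpi {k : ℕ} (hk : k ≤ Module.finrank ℤ Γ) : Nontrivial (∀ s : DPV.RatDim X ⊤ k,
      DPV.CharRing Γ ⧸ DPV.cocircuitIdeal X s.1) := by
    obtain ⟨s, hs, hsk⟩ := DPV.exists_isRational_finrank hrank k hk
    have (s : DPV.RatDim X ⊤ k) := DPV.nontrivial_quotient_cocircuitIdeal s.2.1
    exact Pi.nontrivial_at (⟨s, hs, le_top, hsk⟩ : DPV.RatDim X ⊤ k)
  -- The increasing chain J_i ⊆ ... ⊆ J_{d+1} = R is reversed: j = i gives level d + 1 and j = d + 1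
  -- gives level i. The step from j + 1 to j is then the graded piece of degree d - j + i.
  refine ⟨⟨fun j => DPV.dualFiltration X i (Module.finrank ℤ Γ + 1 - j + i), ?_, ?_, ?_⟩,
    fun k => ⟨fun h => ?_, ?_⟩⟩
  · change DPV.dualFiltration X i (_ - _ + i) = _
    rw [Nat.sub_add_cancel (by omega), DPV.dualFiltration]
    have h1 : DPV.idealJ X (Module.finrank ℤ Γ + 1) = ⊤ := by
      rw [Ideal.eq_top_iff_one, ← DPV.nablaCompl_top X]
      refine DPV.nablaCompl_mem_idealJ
        ⟨Set.univ, by rw [Set.image_univ, DPV.span_range_toV hrank]⟩ ?_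
      rw [finrank_top, DPV.finrank_V]
      omega
    rw [h1, Submodule.map_top, Submodule.range_mkQ]
  · change DPV.dualFiltration X i (_ - _ + i) = _
    rw [Nat.sub_self, zero_add, DPV.dualFiltration_self]
  · intro j hij hj
    have e1 : Module.finrank ℤ Γ + 1 - j + i = Module.finrank ℤ Γ - j + i + 1 := by omega
    have e2 : Module.finrank ℤ Γ + 1 - (j + 1) + i = Module.finrank ℤ Γ - j + i := by omega
    beta_reduce
    rw [e1, e2]
    have e := DPV.gradedEquiv (X := X) (i := i) (k := Module.finrank ℤ Γ - j + i) (by omega)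
    -- The inclusion is strict because the graded piece is a product of nonzero rings over a
    -- nonempty index set.
    refine ⟨lt_of_le_of_ne (DPV.dualFiltration_mono (Nat.le_succ _)) fun heq => ?_, ?_⟩
    · have := hpi (k := Module.finrank ℤ Γ - j + i) (by omega)
      have := e.toEquiv.nontrivial
      refine Submodule.Quotient.nontrivial_iff.1 this ?_
      rw [Submodule.submoduleOf, Submodule.comap_subtype_eq_top, heq]
    · obtain ⟨e'⟩ := hge (Module.finrank ℤ Γ - j + i) (by omega)
      exact ⟨e.trans e'.symm⟩
  · by_contra hk
    rw [not_and_or, not_le, not_le] at hk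
    rcases lt_or_ge k i with hki | hki
    · exact not_subsingleton _ (hlt k hki)
    · obtain ⟨e⟩ := hge k hki
      have : IsEmpty (DPV.RatDim X ⊤ k) := ⟨fun s => by
        have h := Submodule.finrank_le s.1
        rw [s.2.2.2, DPV.finrank_V] at h
        omega⟩
      exact not_subsingleton _ e.toEquiv.subsingleton
  · rintro ⟨h1, h2⟩
    obtain ⟨e⟩ := hge k h1
    have := hpi h2
    exact e.toEquiv.nontrivial
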